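/- Let $d\in\{2,3\}$, $\mathbb T^d=\mathbb R^d/\mathbb Z^d$, $\mathbb Z^d_0=\mathbb Z^d\setminus\{0\}$ and $e_k(x)=e^{2\pi i k\cdot x}$. For $s\in\mathbb R$ let $H^s=H^s(\mathbb T^d;\mathbb R^d)$ be the space of zero-average formal Fourier series $u=\sum_{k\in\mathbb Z^d_0}\hat u_k e_k$ with $\hat u_k\in\mathbb C^d$, $\overline{\hat u_k}=\hat u_{-k}$ and $\|u\|_{H^s}^2=\sum_{k\in\mathbb Z^d_0}|2\pi k|^{2s}|\hat u_k|^2<\infty$; $u$ is divergence free if $k\cdot\hat u_k=0$ for all $k\in\mathbb Z^d_0$. Let $\Pi$ be the Helmholtz–Leray projection, $\Pi u=\sum_{k\in\mathbb Z^d_0}\big(\hat u_k-\frac{k\cdot\hat u_k}{|k|^2}k\big)e_k$. Let $\sigma_{k,i}=a_{k,i}e_k$ for $k\in\mathbb Z^d_0$, $1\le i\le d-1$, where for each $k$ the vectors $\{a_{k,i}\}_{i=1}^{d-1}$ form an orthonormal basis of $k^\perp\subset\mathbb R^d$, and $a_{-k,i}=a_{k,i}$. For $\kappa>0$, $C_d=\frac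 d{d-1}$ and coefficients $\theta=(\theta_k)_{k\in\mathbb Z^d_0}$, the Stratonovich–Itô corrector is $$S^{(d)}_\theta(u)=C_d\,\kappa\sum_{k\in\mathbb Z^d_0}\sum_{i=1}^{d-1}\theta_k^2\,\Pi\big[\sigma_{k,i}\cdot\nabla\,\Pi(\sigma_{-k,i}\cdot\nabla u)\big].$$ For $0<\gamma<\frac d2$ and integers $N\ge1$ put $$\epsilon_N=\Big(\sum_{1\le|k|\le N}|k|^{-2\gamma}\Big)^{-1},\qquad \theta^N_k=\sqrt{\epsilon_N}\,|k|^{-\gamma}\mathbf 1_{\{1\le|k|\le N\}},\qquad D_N=\epsilon_N\sum_{1\le|k|\le N}|k|^{-2\gamma-1},$$ where $k$ ranges over $\mathbb Z^d_0$. **Theorem.** Let $C'_2=\frac14$ and $C'_3=\frac35$. For $d\in\{2,3\}$ and $0<\gamma<\frac d2$ there is a constant $C>0$, depending only on $d$ and $\gamma$, such that for every choice of $\{a_{k,i}\}$ as above, all $\kappa>0$, $N\ge1$, $\alpha\in[0,1]$, $b\in\mathbb R$ and every divergence-free $v\in H^b$, the difference $S^{(d)}_{\theta^N}(v)-C'_d\,\kappa\,\Delta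 v$ belongs to $H^{b-2-\alpha}$ and $$\big\|S^{(d)}_{\theta^N}(v)-C'_d\,\kappa\,\Delta v\big\|_{H^{b-2-\alpha}}\le C\,\kappa\,D_N^{\alpha}\,\|v\|_{H^b}.$$ -/

import Mathlib

namespace ItoCorrector

/-- Formal Fourier series `u = ∑ₖ û(k) eₖ` on the torus `ℝᵈ / ℤᵈ`, with `eₖ(x) = exp(2πi k·x)` and
coefficients `û(k) ∈ ℂᵈ`, recorded by the family of coefficients. -/
abbrev FourierSeries (d : ℕ) : Type := (Fin d → ℤ) → EuclideanSpace ℂ (Fin d)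

/-- The lattice point `k ∈ ℤᵈ` as a vector of Euclidean space `ℝᵈ`; `‖latVec k‖` is `|k|`. -/
noncomputable def latVec {d : ℕ} (k : Fin d → ℤ) : EuclideanSpace ℝ (Fin d) :=
  WithLp.toLp 2 fun j => (k j : ℝ)

/-- `k · w = ∑ⱼ kⱼ wⱼ` for a lattice point `k` and `w ∈ ℂᵈ` (bilinear, no conjugation). -/
noncomputable def latDot {d : ℕ} (k : Fin d → ℤ) (w : EuclideanSpace ℂ (Fin d)) : ℂ :=
  ∑ j, (k j : ℂ) * w j

/-- The lattice point `k ∈ ℤᵈ` as a vector of `ℂᵈ`. -/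
noncomputable def latVecC {d : ℕ} (k : Fin d → ℤ) : EuclideanSpace ℂ (Fin d) :=
  WithLp.toLp 2 fun j => (k j : ℂ)

/-- The derivative `∂ⱼ`, acting on `eₖ` as multiplication by `2πi kⱼ`. -/
noncomputable def partialDeriv {d : ℕ} (j : Fin d) (u : FourierSeries d) : FourierSeries d :=
  fun k => (2 * (Real.pi : ℂ) * Complex.I * (k j : ℂ)) • u k

/-- The Laplacian `Δ = ∑ⱼ ∂ⱼ ∂ⱼ`. -/
noncomputable def laplacian {d : ℕ} (u : FourierSeries d) : FourierSeries d :=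
  ∑ j, partialDeriv j (partialDeriv j u)

/-- Multiplication by the function `eₖ`: since `eₖ eₗ = eₖ₊ₗ`, it shifts the coefficients by `k`. -/
def mulBasis {d : ℕ} (k : Fin d → ℤ) (u : FourierSeries d) : FourierSeries d :=
  fun m => u (m - k)

/-- The transport operator `u ↦ σ · ∇u = ∑ⱼ σⱼ ∂ⱼu` for the vector field `σ = a eₖ`, `a ∈ ℝᵈ`. -/
noncomputable def transport {d : ℕ} (a : EuclideanSpace ℝ (Fin d)) (k : Fin d → ℤ)
    (u : FourierSeries d) : FourierSeries d :=
  ∑ j, ((a j : ℝ) : ℂ) • mulBasis k (partialDeriv j u)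

/-- The Helmholtz-Leray projection onto the divergence free fields of zero average:
`û(k) ↦ û(k) - (k · û(k)) / |k|² k` for `k ≠ 0`. -/
noncomputable def leray {d : ℕ} (u : FourierSeries d) : FourierSeries d :=
  open Classical in
  fun k => if k = 0 then 0 else u k - (latDot k (u k) / ((‖latVec k‖ ^ 2 : ℝ) : ℂ)) • latVecC k

/-- Divergence free: `k · û(k) = 0` for every nonzero lattice point `k`. -/
def IsDivFree {d : ℕ} (u : FourierSeries d) : Prop :=
  ∀ k : Fin d → ℤ, k ≠ 0 → latDot k (u k) = 0

/-- The term `|2πk|^{2s} |û(k)|²` of the squared norm of `Hˢ`. -/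
noncomputable def sobolevTerm {d : ℕ} (s : ℝ) (u : FourierSeries d) (k : Fin d → ℤ) : ℝ :=
  (2 * Real.pi * ‖latVec k‖) ^ (2 * s) * ‖u k‖ ^ 2

/-- Membership in `Hˢ(𝕋ᵈ, ℝᵈ)`, `s ∈ ℝ`: zero average, real valued, and of finite norm. -/
structure MemSobolev {d : ℕ} (s : ℝ) (u : FourierSeries d) : Prop where
  zero_average : u 0 = 0
  real_valued : ∀ (k : Fin d → ℤ) (j : Fin d), star (u k j) = u (-k) j
  summable : Summable fun k : {k : Fin d → ℤ // k ≠ 0} => sobolevTerm s u k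

/-- The norm `‖u‖_{Hˢ} = (∑_{k ≠ 0} |2πk|^{2s} |û(k)|²)^{1/2}`. -/
noncomputable def sobolevNorm {d : ℕ} (s : ℝ) (u : FourierSeries d) : ℝ :=
  Real.sqrt (∑' k : {k : Fin d → ℤ // k ≠ 0}, sobolevTerm s u k)

/-- The amplitudes of the noise vector fields `σₖᵢ = aₖᵢ eₖ`: for every `k ≠ 0`, the vectors
`aₖᵢ`, `1 ≤ i ≤ d - 1`, form an orthonormal basis of the hyperplane `k^⊥`, and `a₋ₖᵢ = aₖᵢ`. -/
structure IsNoiseFrame {d : ℕ} (a : (Fin d → ℤ) → Fin (d - 1) → EuclideanSpace ℝ (Fin d)) :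
    Prop where
  even : ∀ k : Fin d → ℤ, k ≠ 0 → ∀ i, a (-k) i = a k i
  orthonormal : ∀ k : Fin d → ℤ, k ≠ 0 → Orthonormal ℝ (a k)
  span_eq : ∀ k : Fin d → ℤ, k ≠ 0 →
    Submodule.span ℝ (Set.range (a k)) = (Submodule.span ℝ {latVec k})ᗮ

/-- The Stratonovich-Ito corrector
`S_θ(u) = C_d κ ∑_{k ≠ 0} ∑ᵢ θₖ² Π[σₖᵢ · ∇ Π(σ₋ₖᵢ · ∇u)]` with `C_d = d / (d - 1)`; the series is
taken coefficient by coefficient. -/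
noncomputable def corrector {d : ℕ} (a : (Fin d → ℤ) → Fin (d - 1) → EuclideanSpace ℝ (Fin d))
    (κ : ℝ) (θ : (Fin d → ℤ) → ℝ) (u : FourierSeries d) : FourierSeries d :=
  fun m => (((d : ℝ) / ((d : ℝ) - 1) * κ : ℝ) : ℂ) •
    ∑' k : {k : Fin d → ℤ // k ≠ 0}, ∑ i : Fin (d - 1),
      ((θ k ^ 2 : ℝ) : ℂ) •
        leray (transport (a k i) k (leray (transport (a (-k) i) (-k) u))) m

/-- The finite set of the lattice points `k ∈ ℤᵈ` with `1 ≤ |k| ≤ N`. -/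
noncomputable def latticeBall (d N : ℕ) : Finset (Fin d → ℤ) :=
  open Classical in
  (Fintype.piFinset fun _ : Fin d => Finset.Icc (-(N : ℤ)) (N : ℤ)).filter
    fun k => 1 ≤ ‖latVec k‖ ∧ ‖latVec k‖ ≤ (N : ℝ)

theorem mem_latticeBall {d N : ℕ} (k : Fin d → ℤ) :
    k ∈ latticeBall d N ↔ 1 ≤ ‖latVec k‖ ∧ ‖latVec k‖ ≤ (N : ℝ) := by
  classical
  simp only [latticeBall, Finset.mem_filter, Fintype.mem_piFinset, Finset.mem_Icc,
    and_iff_right_iff_imp]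
  intro h j
  have h1 : ‖latVec k j‖ ≤ ‖latVec k‖ := PiLp.norm_apply_le (latVec k) j
  have h2 : |(k j : ℝ)| ≤ (N : ℝ) := by
    simpa [latVec, Real.norm_eq_abs] using h1.trans h.2
  have h3 := abs_le.mp h2
  exact ⟨by exact_mod_cast h3.1, by exact_mod_cast h3.2⟩

/-- `ε_N = (∑_{1 ≤ |k| ≤ N} |k|^{-2γ})⁻¹`. -/
noncomputable def epsN (d : ℕ) (γ : ℝ) (N : ℕ) : ℝ :=
  (∑ k ∈ latticeBall d N, 1 / ‖latVec k‖ ^ (2 * γ))⁻¹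

/-- `θ^N_k = √ε_N |k|^{-γ} 1_{1 ≤ |k| ≤ N}`. -/
noncomputable def thetaN (d : ℕ) (γ : ℝ) (N : ℕ) (k : Fin d → ℤ) : ℝ :=
  open Classical in
  if 1 ≤ ‖latVec k‖ ∧ ‖latVec k‖ ≤ (N : ℝ) then
    Real.sqrt (epsN d γ N) * (1 / ‖latVec k‖ ^ γ) else 0

/-- `D_N = ε_N ∑_{1 ≤ |k| ≤ N} |k|^{-(2γ+1)}`. -/
noncomputable def decayN (d : ℕ) (γ : ℝ) (N : ℕ) : ℝ :=
  epsN d γ N * ∑ k ∈ latticeBall d N, 1 / ‖latVec k‖ ^ (2 * γ + 1)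

end ItoCorrector

open ItoCorrector

namespace ItoCorrector

open MeasureTheory

variable {d : ℕ}

/-! On divergence-free fields the corrector is diagonal in Fourier space (`corrector_apply`). At
frequency m, up to the factor -4π² C_d κ, it sends w = v̂(m) to the sum over k of θ_k² |m|²
sin²∠(k,m) times w - (k·w)/|m-k|² P_m k, where P_m is the projection orthogonal to m. Everything
reduces to comparing this symbol with that of the Laplacian.

Two errors occur. The first comes from replacing |m-k| by |k|. The singularity at k near m is
harmless because |P_m k| is at most both |k| and |m-k|. Each term then changes by at most |m|²|w|
θ_k² min(1, 2|m|/|k|), which sums to O(|m|²|w| min(1, |m| D_N)); this is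
`norm_sum_thetaN_sq_shift_le`.

After this replacement only second and fourth moments of a radial weight on the lattice ball remain.
Sign changes and permutations of coordinates make the second moments isotropic and leave two free
numbers in the fourth moments (`moment4_eq`). If the defect M_pppp - 3 M_ppqq were zero, the fourth
moments would be isotropic too, and the symbol would be exactly that of the effective Laplacian.

The second error is this defect. It is half the weighted lattice sum of Re (k_p + i k_q)⁴, a
function whose sign is reversed by a reflection in the (p,q)-plane, so its integral over any annulus
vanishes. Comparing the sum with the integral cell by cell costs one power of |k|, plus
contributions near the origin and near the sphere of radius N. All are dominated by the sum of
|k|^(-2γ-1), so the defect is O(D_N); see `exists_abs_sum_quarticProfile_le`.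

Both errors are thus O(min(1, |m| D_N)) relative to |m|²|w|. Since min(1, x) ≤ x^α, this yields
D_N^α |m|^(2+α) |w| (`exists_norm_corrector_sub_laplacian_le`), and a termwise comparison of Sobolev
norms finishes the proof. -/

/-! ### Symmetries of the lattice ball. -/

theorem latVec_apply (k : Fin d → ℤ) (j : Fin d) : latVec k j = (k j : ℝ) := rfl

theorem norm_latVec_sq (k : Fin d → ℤ) : ‖latVec k‖ ^ 2 = ∑ j, (k j : ℝ) ^ 2 := by
  simp [EuclideanSpace.norm_sq_eq, latVec_apply]

theorem norm_latVec_congr {k l : Fin d → ℤ} (h : ∑ j, (k j : ℝ) ^ 2 = ∑ j, (l j : ℝ) ^ 2) :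
    ‖latVec k‖ = ‖latVec l‖ := by
  rw [← norm_latVec_sq, ← norm_latVec_sq] at h
  exact (pow_left_inj₀ (norm_nonneg _) (norm_nonneg _) two_ne_zero).mp h

theorem norm_latVec_neg (k : Fin d → ℤ) : ‖latVec (-k)‖ = ‖latVec k‖ :=
  norm_latVec_congr (by simp)

theorem norm_latVec_perm (σ : Equiv.Perm (Fin d)) (k : Fin d → ℤ) :
    ‖latVec (k ∘ σ)‖ = ‖latVec k‖ :=
  norm_latVec_congr (Equiv.sum_comp σ fun j => (k j : ℝ) ^ 2)

/-- Change of sign of one coordinate. -/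
def flipCoord (p : Fin d) (k : Fin d → ℤ) : Fin d → ℤ :=
  fun j => if j = p then -k j else k j

theorem flipCoord_flipCoord (p : Fin d) (k : Fin d → ℤ) : flipCoord p (flipCoord p k) = k := by
  funext j
  by_cases h : j = p <;> simp [flipCoord, h]

theorem norm_latVec_flip (p : Fin d) (k : Fin d → ℤ) : ‖latVec (flipCoord p k)‖ = ‖latVec k‖ := by
  refine norm_latVec_congr (Finset.sum_congr rfl fun j _ => ?_)
  by_cases h : j = p <;> simp [flipCoord, h]

theorem sum_latticeBall_equiv {M : Type*} [AddCommMonoid M] {N : ℕ}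
    (e : (Fin d → ℤ) ≃ (Fin d → ℤ)) (he : ∀ k, ‖latVec (e k)‖ = ‖latVec k‖)
    (F : (Fin d → ℤ) → M) :
    ∑ k ∈ latticeBall d N, F (e k) = ∑ k ∈ latticeBall d N, F k :=
  Finset.sum_equiv e (fun k => by simp [mem_latticeBall, he]) fun _ _ => rfl

theorem sum_latticeBall_neg {M : Type*} [AddCommMonoid M] {N : ℕ} (F : (Fin d → ℤ) → M) :
    ∑ k ∈ latticeBall d N, F (-k) = ∑ k ∈ latticeBall d N, F k :=
  sum_latticeBall_equiv (Equiv.neg _) norm_latVec_neg F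

theorem sum_latticeBall_perm {N : ℕ} (σ : Equiv.Perm (Fin d)) (F : (Fin d → ℤ) → ℝ) :
    ∑ k ∈ latticeBall d N, F (k ∘ σ) = ∑ k ∈ latticeBall d N, F k :=
  sum_latticeBall_equiv (Equiv.arrowCongr σ.symm (Equiv.refl ℤ)) (fun k => norm_latVec_perm σ k) F

theorem sum_latticeBall_flip {N : ℕ} (p : Fin d) (F : (Fin d → ℤ) → ℝ) :
    ∑ k ∈ latticeBall d N, F (flipCoord p k) = ∑ k ∈ latticeBall d N, F k :=
  sum_latticeBall_equiv
    ⟨flipCoord p, flipCoord p, flipCoord_flipCoord p, flipCoord_flipCoord p⟩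
    (norm_latVec_flip p) F

theorem sum_latticeBall_eq_zero_of_flip {N : ℕ} (p : Fin d) (F : (Fin d → ℤ) → ℝ)
    (h : ∀ k, F (flipCoord p k) = -F k) : ∑ k ∈ latticeBall d N, F k = 0 := by
  have := sum_latticeBall_flip (N := N) p F
  simp only [h, Finset.sum_neg_distrib] at this
  linarith

/-! ### Second and fourth moments of radial weights. -/

/-- Second moments of a radial weight on the lattice ball. -/
noncomputable def moment2 (d N : ℕ) (φ : ℝ → ℝ) (i j : Fin d) : ℝ :=
  ∑ k ∈ latticeBall d N, φ ‖latVec k‖ * ((k i : ℝ) * k j)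

/-- Fourth moments of a radial weight on the lattice ball. -/
noncomputable def moment4 (d N : ℕ) (φ : ℝ → ℝ) (i j m n : Fin d) : ℝ :=
  ∑ k ∈ latticeBall d N, φ ‖latVec k‖ * ((k i : ℝ) * k j * k m * k n)

variable {N : ℕ} {φ : ℝ → ℝ}

theorem moment2_of_ne {i j : Fin d} (h : i ≠ j) : moment2 d N φ i j = 0 := by
  refine sum_latticeBall_eq_zero_of_flip i _ fun k => ?_
  simp [norm_latVec_flip, flipCoord, h.symm]

theorem moment2_perm (σ : Equiv.Perm (Fin d)) (i j : Fin d) :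
    moment2 d N φ (σ i) (σ j) = moment2 d N φ i j := by
  unfold moment2
  rw [← sum_latticeBall_perm σ fun k => φ ‖latVec k‖ * ((k i : ℝ) * k j)]
  simp [norm_latVec_perm]

/-- Transpositions make all diagonal entries equal, so each is the trace divided by d. -/
theorem moment2_eq (i j : Fin d) : (d : ℝ) * moment2 d N φ i j =
    if i = j then ∑ k ∈ latticeBall d N, φ ‖latVec k‖ * ‖latVec k‖ ^ 2 else 0 := by
  split_ifs with h
  · subst h
    have hc : ∀ j, moment2 d N φ j j = moment2 d N φ i i := fun j => by
      simpa using moment2_perm (N := N) (φ := φ) (Equiv.swap i j) i i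
    have hs : ∑ j, moment2 d N φ j j =
        ∑ k ∈ latticeBall d N, φ ‖latVec k‖ * ‖latVec k‖ ^ 2 := by
      simp only [moment2]
      rw [Finset.sum_comm]
      refine Finset.sum_congr rfl fun k _ => ?_
      rw [norm_latVec_sq, Finset.mul_sum]
      exact Finset.sum_congr rfl fun j _ => by ring
    rw [← hs, Finset.sum_congr rfl fun j _ => hc j]
    simp
  · simp [moment2_of_ne h]

theorem moment4_perm (σ : Equiv.Perm (Fin d)) (i j m n : Fin d) :
    moment4 d N φ (σ i) (σ j) (σ m) (σ n) = moment4 d N φ i j m n := by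
  unfold moment4
  rw [← sum_latticeBall_perm σ fun k => φ ‖latVec k‖ * ((k i : ℝ) * k j * k m * k n)]
  simp [norm_latVec_perm]

/-- Changing the sign of the i-th coordinate reverses the summand, in which it occurs exactly once.
-/
theorem moment4_isolated {i j m n : Fin d} (h1 : j ≠ i) (h2 : m ≠ i) (h3 : n ≠ i) :
    moment4 d N φ i j m n = 0 := by
  refine sum_latticeBall_eq_zero_of_flip i _ fun k => ?_
  simp [norm_latVec_flip, flipCoord, h1, h2, h3]

theorem moment4_comm12 (i j m n : Fin d) : moment4 d N φ i j m n = moment4 d N φ j i m n :=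
  Finset.sum_congr rfl fun k _ => by ring

theorem moment4_comm23 (i j m n : Fin d) : moment4 d N φ i j m n = moment4 d N φ i m j n :=
  Finset.sum_congr rfl fun k _ => by ring

theorem moment4_comm34 (i j m n : Fin d) : moment4 d N φ i j m n = moment4 d N φ i j n m :=
  Finset.sum_congr rfl fun k _ => by ring

theorem moment4_diag (p i : Fin d) : moment4 d N φ i i i i = moment4 d N φ p p p p := by
  simpa using moment4_perm (N := N) (φ := φ) (Equiv.swap p i) p p p p

theorem moment4_pairs_symm (i j : Fin d) : moment4 d N φ i i j j = moment4 d N φ j j i i :=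
  Finset.sum_congr rfl fun k _ => by ring

theorem moment4_pairs_right {i j m : Fin d} (hj : i ≠ j) (hm : i ≠ m) :
    moment4 d N φ i i j j = moment4 d N φ i i m m := by
  simpa [Equiv.swap_apply_of_ne_of_ne hj hm] using
    (moment4_perm (N := N) (φ := φ) (Equiv.swap j m) i i j j).symm

/-- Permutations act transitively on ordered pairs of distinct coordinates; here one index is moved
at a time. -/
theorem moment4_pairs {p q i j : Fin d} (hpq : p ≠ q) (hij : i ≠ j) :
    moment4 d N φ i i j j = moment4 d N φ p p q q := by
  by_cases h : i = q
  · subst h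
    rw [moment4_pairs_right hij hpq.symm, moment4_pairs_symm]
  · rw [moment4_pairs_right hij h, moment4_pairs_symm, moment4_pairs_right (Ne.symm h) hpq.symm,
      moment4_pairs_symm]

/-- The fourth moment tensor of a radial weight is determined by two numbers. -/
theorem moment4_eq {p q : Fin d} (hpq : p ≠ q) (i j m n : Fin d) :
    moment4 d N φ i j m n =
      moment4 d N φ p p q q *
        ((if i = j then if m = n then 1 else 0 else 0) +
         (if i = m then if j = n then 1 else 0 else 0) +
         (if i = n then if j = m then 1 else 0 else 0)) +
      (moment4 d N φ p p p p - 3 * moment4 d N φ p p q q) *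
        (if i = j then if i = m then if i = n then 1 else 0 else 0 else 0) := by
  by_cases h1 : i = j
  · subst h1
    by_cases h2 : m = n
    · subst h2
      by_cases h3 : i = m
      · subst h3
        simp [moment4_diag p i]
        ring
      · simp [h3, moment4_pairs hpq h3]
    · by_cases h3 : m = i
      · subst h3
        rw [moment4_comm34, moment4_comm23, moment4_comm12, moment4_isolated h2 h2 h2]
        simp [h2]
      · rw [moment4_comm23, moment4_comm12, moment4_isolated (Ne.symm h3) (Ne.symm h3) (Ne.symm h2)]
        simp [h2, Ne.symm h3]
  · by_cases h2 : i = m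
    · subst h2
      by_cases h3 : j = n
      · subst h3
        rw [moment4_comm23, moment4_pairs hpq h1]
        simp [h1]
      · rw [moment4_comm12, moment4_isolated h1 h1 (Ne.symm h3)]
        simp [h1, h3, Ne.symm h1]
    · by_cases h3 : i = n
      · subst h3
        by_cases h4 : j = m
        · subst h4
          rw [moment4_comm34, moment4_comm23, moment4_pairs hpq h1]
          simp [h1]
        · rw [moment4_comm12, moment4_isolated h1 (Ne.symm h4) h1]
          simp [h1, h2, h4]
      · rw [moment4_isolated (Ne.symm h1) (Ne.symm h2) (Ne.symm h3)]
        simp [h1, h2, h3]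

/-- Expand |k|⁴ as the square of ∑ k_i² and count diagonal and off-diagonal pairs. -/
theorem moment4_trace {p q : Fin d} (hpq : p ≠ q) :
    (d : ℝ) * (moment4 d N φ p p p p + ((d : ℝ) - 1) * moment4 d N φ p p q q) =
      ∑ k ∈ latticeBall d N, φ ‖latVec k‖ * ‖latVec k‖ ^ 4 := by
  have hd : 0 < d := p.pos
  have h1 : ∀ i, ∑ j, moment4 d N φ i i j j =
      moment4 d N φ p p p p + ((d : ℝ) - 1) * moment4 d N φ p p q q := fun i => by
    rw [← Finset.add_sum_erase _ _ (Finset.mem_univ i), moment4_diag p i,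
      Finset.sum_congr rfl fun j hj => moment4_pairs hpq (Finset.ne_of_mem_erase hj).symm]
    simp [Nat.cast_sub (Nat.one_le_iff_ne_zero.mpr hd.ne')]
  have h2 : ∑ i, ∑ j, moment4 d N φ i i j j =
      ∑ k ∈ latticeBall d N, φ ‖latVec k‖ * ‖latVec k‖ ^ 4 := by
    simp only [moment4]
    rw [Finset.sum_congr rfl fun i _ => Finset.sum_comm, Finset.sum_comm]
    refine Finset.sum_congr rfl fun k _ => ?_
    rw [show ‖latVec k‖ ^ 4 = ‖latVec k‖ ^ 2 * ‖latVec k‖ ^ 2 by ring, norm_latVec_sq,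
      Finset.sum_mul_sum, Finset.mul_sum]
    refine Finset.sum_congr rfl fun i _ => ?_
    rw [Finset.mul_sum]
    exact Finset.sum_congr rfl fun j _ => by ring
  rw [← h2, Finset.sum_congr rfl fun i _ => h1 i]
  simp only [Finset.sum_const, Finset.card_univ, Fintype.card_fin, nsmul_eq_mul]

/-- The diagonal moments at p and q agree, so doubling symmetrises the defect into a sum of Re (k_p
+ i k_q)⁴. -/
theorem moment4_anisotropy {p q : Fin d} :
    2 * (moment4 d N φ p p p p - 3 * moment4 d N φ p p q q) =
      ∑ k ∈ latticeBall d N, φ ‖latVec k‖ *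
        ((k p : ℝ) ^ 4 + (k q : ℝ) ^ 4 - 6 * (k p : ℝ) ^ 2 * (k q : ℝ) ^ 2) := by
  have h := moment4_diag (N := N) (φ := φ) p q
  rw [show 2 * (moment4 d N φ p p p p - 3 * moment4 d N φ p p q q) =
    moment4 d N φ p p p p + moment4 d N φ q q q q - 6 * moment4 d N φ p p q q by rw [h]; ring]
  simp only [moment4, Finset.mul_sum, ← Finset.sum_add_distrib, ← Finset.sum_sub_distrib]
  exact Finset.sum_congr rfl fun k _ => by ring

/-! ### The quartic harmonic: size and oscillation. -/

/-- The real part of `(xₚ + i x_q)⁴`. -/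
def quartic (p q : Fin d) (x : EuclideanSpace ℝ (Fin d)) : ℝ :=
  x p ^ 4 + x q ^ 4 - 6 * x p ^ 2 * x q ^ 2

/-- The function `|x|^{-s} Q(x / |x|)`, with `Q` the quartic harmonic. -/
noncomputable def quarticProfile (p q : Fin d) (s : ℝ) (x : EuclideanSpace ℝ (Fin d)) : ℝ :=
  ‖x‖ ^ (-s) * quartic p q (‖x‖⁻¹ • x)

theorem abs_apply_le_norm (x : EuclideanSpace ℝ (Fin d)) (j : Fin d) : |x j| ≤ ‖x‖ := by
  simpa using PiLp.norm_apply_le x j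

theorem norm_inv_smul_le_one (x : EuclideanSpace ℝ (Fin d)) : ‖‖x‖⁻¹ • x‖ ≤ 1 := by
  rw [norm_smul, norm_inv, norm_norm]
  exact inv_mul_le_one

theorem abs_quartic_le {p q : Fin d} {x : EuclideanSpace ℝ (Fin d)} (hx : ‖x‖ ≤ 1) :
    |quartic p q x| ≤ 8 := by
  have h1 := sq_le_one_iff_abs_le_one _ |>.mpr ((abs_apply_le_norm x p).trans hx)
  have h2 := sq_le_one_iff_abs_le_one _ |>.mpr ((abs_apply_le_norm x q).trans hx)
  unfold quartic
  have e1 := sq_nonneg (x p)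
  have e2 := sq_nonneg (x q)
  have e3 := mul_nonneg e1 e2
  have e4 : x p ^ 2 * x q ^ 2 ≤ 1 := mul_le_one₀ h1 e2 h2
  have e5 : x p ^ 4 = x p ^ 2 * x p ^ 2 := by ring
  have e6 : x q ^ 4 = x q ^ 2 * x q ^ 2 := by ring
  have e7 : x p ^ 2 * x p ^ 2 ≤ 1 := mul_le_one₀ h1 e1 h1
  have e8 : x q ^ 2 * x q ^ 2 ≤ 1 := mul_le_one₀ h2 e2 h2
  have e9 := mul_nonneg e1 e1
  have e10 := mul_nonneg e2 e2
  rw [e5, e6, abs_le]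
  constructor <;> linarith

theorem abs_quartic_sub_le {p q : Fin d} {x y : EuclideanSpace ℝ (Fin d)} (hx : ‖x‖ ≤ 1)
    (hy : ‖y‖ ≤ 1) : |quartic p q x - quartic p q y| ≤ 32 * ‖x - y‖ := by
  have hxp := (abs_apply_le_norm x p).trans hx
  have hxq := (abs_apply_le_norm x q).trans hx
  have hyp := (abs_apply_le_norm y p).trans hy
  have hyq := (abs_apply_le_norm y q).trans hy
  have hp : |x p - y p| ≤ ‖x - y‖ := by simpa using abs_apply_le_norm (x - y) p
  have hq : |x q - y q| ≤ ‖x - y‖ := by simpa using abs_apply_le_norm (x - y) q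
  have key : ∀ n : ℕ, ∀ a b : ℝ, |a| ≤ 1 → |b| ≤ 1 → |a ^ n - b ^ n| ≤ n * |a - b| :=
    fun n a b ha hb => by
      refine (abs_pow_sub_pow_le a b n).trans ?_
      have h : max |a| |b| ^ (n - 1) ≤ 1 :=
        pow_le_one₀ (le_max_of_le_left (abs_nonneg a)) (max_le ha hb)
      calc _ ≤ |a - b| * n * 1 := by gcongr
        _ = _ := by ring
  have k1 := key 4 _ _ hxp hyp
  have k2 := key 4 _ _ hxq hyq
  have k3 := key 2 _ _ hxp hyp
  have k4 := key 2 _ _ hxq hyq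
  have b1 : |x q ^ 2| ≤ 1 := by rw [abs_pow]; exact pow_le_one₀ (abs_nonneg _) hxq
  have b2 : |y p ^ 2| ≤ 1 := by rw [abs_pow]; exact pow_le_one₀ (abs_nonneg _) hyp
  have m1 : |(x p ^ 2 - y p ^ 2) * x q ^ 2| ≤ 2 * ‖x - y‖ := by
    rw [abs_mul]
    calc _ ≤ |x p ^ 2 - y p ^ 2| * 1 := by gcongr
      _ ≤ _ := by push_cast at k3; linarith
  have m2 : |y p ^ 2 * (x q ^ 2 - y q ^ 2)| ≤ 2 * ‖x - y‖ := by
    rw [abs_mul]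
    calc _ ≤ 1 * |x q ^ 2 - y q ^ 2| := by gcongr
      _ ≤ _ := by push_cast at k4; linarith
  unfold quartic
  push_cast at k1 k2
  have e1 := abs_le.mp (k1.trans (mul_le_mul_of_nonneg_left hp (by norm_num)))
  have e2 := abs_le.mp (k2.trans (mul_le_mul_of_nonneg_left hq (by norm_num)))
  have e3 := abs_le.mp m1
  have e4 := abs_le.mp m2
  -- The constant is 32 = 4 + 4 + 6·(2 + 2): two fourth powers, and the product of squares changed
  -- one factor at a time.
  rw [abs_le]
  constructor <;> nlinarith only [e1.1, e1.2, e2.1, e2.2, e3.1, e3.2, e4.1, e4.2]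

/-- Changing the vector and then its normalising factor contributes at most ‖x - y‖ / ‖y‖ each. -/
theorem norm_normalize_sub_le {E : Type*} [NormedAddCommGroup E] [NormedSpace ℝ E] {x y : E}
    (hx : x ≠ 0) (hy : y ≠ 0) : ‖‖x‖⁻¹ • x - ‖y‖⁻¹ • y‖ ≤ 2 * ‖x - y‖ / ‖y‖ := by
  have hx' := norm_pos_iff.mpr hx
  have hy' := norm_pos_iff.mpr hy
  have h : ‖x‖⁻¹ • x - ‖y‖⁻¹ • y = ‖y‖⁻¹ • (x - y) + (‖y‖⁻¹ * (‖y‖ - ‖x‖)) • (‖x‖⁻¹ • x) := by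
    rw [smul_sub, smul_smul, mul_assoc, sub_mul, mul_inv_cancel₀ hx'.ne', mul_sub, ← mul_assoc,
      inv_mul_cancel₀ hy'.ne', sub_smul, one_mul, mul_one]
    abel
  rw [h]
  refine (norm_add_le _ _).trans ?_
  rw [norm_smul, norm_smul, norm_smul, norm_inv, norm_norm, norm_mul, norm_inv, norm_norm,
    norm_inv, norm_norm, inv_mul_cancel₀ hx'.ne', mul_one, Real.norm_eq_abs]
  have := abs_norm_sub_norm_le y x
  rw [norm_sub_rev] at this
  calc _ ≤ ‖y‖⁻¹ * ‖x - y‖ + ‖y‖⁻¹ * ‖x - y‖ := by gcongr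
    _ = _ := by ring

/-- Mean value inequality on [m, ∞), where the derivative is largest in modulus at m. -/
theorem abs_rpow_neg_sub_le {s m a b : ℝ} (hs : 0 < s) (hm : 0 < m) (ha : m ≤ a) (hb : m ≤ b) :
    |a ^ (-s) - b ^ (-s)| ≤ s * m ^ (-s - 1) * |a - b| := by
  have := (convex_Ici m).norm_image_sub_le_of_norm_hasDerivWithin_le (f := fun x : ℝ => x ^ (-s))
    (f' := fun x => -s * x ^ (-s - 1)) (C := s * m ^ (-s - 1)) (x := b) (y := a) (fun x hx =>
      (Real.hasDerivAt_rpow_const (Or.inl (hm.trans_le hx).ne')).hasDerivWithinAt) (fun x hx => by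
        have hx0 : 0 < x := hm.trans_le hx
        rw [norm_mul, norm_neg, Real.norm_of_nonneg hs.le,
          Real.norm_of_nonneg (Real.rpow_nonneg hx0.le _)]
        exact mul_le_mul_of_nonneg_left
          (Real.rpow_le_rpow_of_nonpos hm hx (by linarith)) hs.le) hb ha
  simpa using this

theorem abs_quarticProfile_le (p q : Fin d) (s : ℝ) (x : EuclideanSpace ℝ (Fin d)) :
    |quarticProfile p q s x| ≤ 8 * ‖x‖ ^ (-s) := by
  rw [quarticProfile, abs_mul, abs_of_nonneg (Real.rpow_nonneg (norm_nonneg x) _), mul_comm]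
  exact mul_le_mul_of_nonneg_right (abs_quartic_le (norm_inv_smul_le_one x))
    (Real.rpow_nonneg (norm_nonneg x) _)

/-- Oscillation of the profile at a bounded distance, away from the origin. -/
theorem abs_quarticProfile_sub_le (p q : Fin d) {s ρ : ℝ} (hs : 0 < s) (hρ : 0 ≤ ρ)
    {x y : EuclideanSpace ℝ (Fin d)} (hx : 1 ≤ ‖x‖) (hy : 1 ≤ ‖y‖) (hxy : ‖x - y‖ ≤ ρ) :
    |quarticProfile p q s x - quarticProfile p q s y| ≤
      (8 * s * (1 + ρ) ^ (s + 1) * ρ + 64 * ρ) * ‖y‖ ^ (-s - 1) := by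
  have hx0 : 0 < ‖x‖ := by linarith
  have hy0 : 0 < ‖y‖ := by linarith
  have hyx : ‖y‖ ≤ (1 + ρ) * ‖x‖ := by
    have := norm_sub_norm_le y x
    rw [norm_sub_rev] at this
    nlinarith
  have hm : ‖y‖ / (1 + ρ) ≤ ‖x‖ := by
    rw [div_le_iff₀ (by linarith)]
    linarith
  have hm' : ‖y‖ / (1 + ρ) ≤ ‖y‖ := div_le_self hy0.le (by linarith)
  have h1 := abs_rpow_neg_sub_le hs (by positivity) hm hm'
  have h2 : |‖x‖ - ‖y‖| ≤ ρ := (abs_norm_sub_norm_le x y).trans hxy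
  have h3 : (‖y‖ / (1 + ρ)) ^ (-s - 1) = (1 + ρ) ^ (s + 1) * ‖y‖ ^ (-s - 1) := by
    rw [Real.div_rpow hy0.le (by linarith), show -s - 1 = -(s + 1) by ring,
      Real.rpow_neg (by linarith : (0 : ℝ) ≤ 1 + ρ), div_inv_eq_mul, mul_comm]
  have h4 := abs_quartic_sub_le (p := p) (q := q) (norm_inv_smul_le_one x)
    (norm_inv_smul_le_one y)
  have h5 := norm_normalize_sub_le (norm_pos_iff.mp hx0) (norm_pos_iff.mp hy0)
  have h6 : ‖y‖ ^ (-s - 1) = ‖y‖ ^ (-s) / ‖y‖ := Real.rpow_sub_one hy0.ne' _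
  have e : quarticProfile p q s x - quarticProfile p q s y =
      (‖x‖ ^ (-s) - ‖y‖ ^ (-s)) * quartic p q (‖x‖⁻¹ • x) +
        ‖y‖ ^ (-s) * (quartic p q (‖x‖⁻¹ • x) - quartic p q (‖y‖⁻¹ • y)) := by
    unfold quarticProfile; ring
  rw [e]
  refine (abs_add_le _ _).trans ?_
  rw [abs_mul, abs_mul, abs_of_nonneg (Real.rpow_nonneg hy0.le (-s))]
  have t1 : |‖x‖ ^ (-s) - ‖y‖ ^ (-s)| * |quartic p q (‖x‖⁻¹ • x)| ≤
      (s * ((1 + ρ) ^ (s + 1) * ‖y‖ ^ (-s - 1)) * ρ) * 8 := by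
    rw [h3] at h1
    exact mul_le_mul (h1.trans (mul_le_mul_of_nonneg_left h2 (by positivity)))
      (abs_quartic_le (norm_inv_smul_le_one x)) (abs_nonneg _) (by positivity)
  have t2 : ‖y‖ ^ (-s) * |quartic p q (‖x‖⁻¹ • x) - quartic p q (‖y‖⁻¹ • y)| ≤
      ‖y‖ ^ (-s) * (32 * (2 * ρ / ‖y‖)) := by
    gcongr
    refine h4.trans (mul_le_mul_of_nonneg_left (h5.trans ?_) (by norm_num))
    gcongr
  calc _ ≤ _ := add_le_add t1 t2
    _ = _ := by rw [h6]; ring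

/-! ### Cancellation of the quartic harmonic on annuli. -/

/-- The reflection `(xₚ, x_q) ↦ ((xₚ + x_q) / √2, (xₚ - x_q) / √2)`. -/
noncomputable def eighthReflectionMap (p q : Fin d) :
    EuclideanSpace ℝ (Fin d) →ₗ[ℝ] EuclideanSpace ℝ (Fin d) where
  toFun x := WithLp.toLp 2 fun j =>
    if j = p then (x p + x q) / Real.sqrt 2 else if j = q then (x p - x q) / Real.sqrt 2 else x j
  map_add' x y := by
    ext j
    simp only [PiLp.add_apply]
    split_ifs <;> ring
  map_smul' c x := by
    ext j
    simp only [PiLp.smul_apply, smul_eq_mul, RingHom.id_apply]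
    split_ifs <;> ring

theorem eighthReflectionMap_apply (p q : Fin d) (x : EuclideanSpace ℝ (Fin d)) (j : Fin d) :
    eighthReflectionMap p q x j = if j = p then (x p + x q) / Real.sqrt 2 else
      if j = q then (x p - x q) / Real.sqrt 2 else x j := rfl

theorem norm_eighthReflectionMap {p q : Fin d} (h : p ≠ q) (x : EuclideanSpace ℝ (Fin d)) :
    ‖eighthReflectionMap p q x‖ = ‖x‖ := by
  rw [← pow_left_inj₀ (norm_nonneg _) (norm_nonneg _) two_ne_zero, EuclideanSpace.norm_sq_eq,
    EuclideanSpace.norm_sq_eq, ← sub_eq_zero, ← Finset.sum_sub_distrib, Fintype.sum_eq_add p q h]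
  · simp only [eighthReflectionMap_apply, if_neg h.symm, if_true, Real.norm_eq_abs, sq_abs,
      div_pow, Real.sq_sqrt zero_le_two]
    ring
  · intro j hj
    simp [eighthReflectionMap_apply, hj.1, hj.2]

/-- In the (p,q)-plane the map sends the polar angle t to π/4 - t, hence cos 4t to -cos 4t, while
all norms are preserved. -/
theorem quarticProfile_eighthReflectionMap {p q : Fin d} (h : p ≠ q) (s : ℝ)
    (x : EuclideanSpace ℝ (Fin d)) :
    quarticProfile p q s (eighthReflectionMap p q x) = -quarticProfile p q s x := by
  unfold quarticProfile quartic
  rw [norm_eighthReflectionMap h]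
  simp only [PiLp.smul_apply, smul_eq_mul, eighthReflectionMap_apply, if_neg h.symm, if_true,
    mul_pow, div_pow]
  rw [show Real.sqrt 2 ^ 4 = (Real.sqrt 2 ^ 2) ^ 2 by ring, Real.sq_sqrt zero_le_two]
  ring

/-- The profile has integral zero on every annulus. -/
theorem integral_quarticProfile {p q : Fin d} (h : p ≠ q) (s r R : ℝ) :
    ∫ x, Set.indicator {x : EuclideanSpace ℝ (Fin d) | r ≤ ‖x‖ ∧ ‖x‖ ≤ R}
      (quarticProfile p q s) x = 0 := by
  let L : EuclideanSpace ℝ (Fin d) ≃ₗᵢ[ℝ] EuclideanSpace ℝ (Fin d) :=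
    LinearIsometry.toLinearIsometryEquiv
      ⟨eighthReflectionMap p q, norm_eighthReflectionMap h⟩ rfl
  have hL : ∀ x, L x = eighthReflectionMap p q x := fun _ => rfl
  have h1 := L.measurePreserving.integral_comp L.toHomeomorph.measurableEmbedding
    (Set.indicator {x : EuclideanSpace ℝ (Fin d) | r ≤ ‖x‖ ∧ ‖x‖ ≤ R} (quarticProfile p q s))
  have h2 : ∀ x, Set.indicator {x : EuclideanSpace ℝ (Fin d) | r ≤ ‖x‖ ∧ ‖x‖ ≤ R}
      (quarticProfile p q s) (L x) = -Set.indicator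
        {x : EuclideanSpace ℝ (Fin d) | r ≤ ‖x‖ ∧ ‖x‖ ≤ R} (quarticProfile p q s) x := by
    intro x
    simp only [Set.indicator_apply, Set.mem_ofPred_eq, hL, norm_eighthReflectionMap h,
      quarticProfile_eighthReflectionMap h]
    split_ifs <;> simp
  simp only [h2, integral_neg] at h1
  linarith

theorem measurable_quarticProfile (p q : Fin d) (s : ℝ) : Measurable (quarticProfile p q s) := by
  unfold quarticProfile quartic
  simp only [PiLp.smul_apply, smul_eq_mul]
  fun_prop

/-! ### Unit cells, lattice counting and comparison of sums with integrals. -/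

/-- The lattice point below `x`. -/
noncomputable def latFloor (x : EuclideanSpace ℝ (Fin d)) : Fin d → ℤ := fun j => ⌊x j⌋

theorem norm_sub_latFloor_le (x : EuclideanSpace ℝ (Fin d)) : ‖x - latVec (latFloor x)‖ ≤ d := by
  have h : ‖x - latVec (latFloor x)‖ ≤ Real.sqrt (d * 1) := by
    rw [EuclideanSpace.norm_eq]
    refine Real.sqrt_le_sqrt ?_
    calc _ ≤ ∑ _j : Fin d, (1 : ℝ) := by
          refine Finset.sum_le_sum fun j _ => ?_
          have h0 := Int.floor_le (x j)
          have h1 := Int.lt_floor_add_one (x j)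
          simp only [PiLp.sub_apply, latVec_apply, latFloor, Real.norm_eq_abs, sq_abs]
          nlinarith
      _ = _ := by simp
  refine h.trans (Real.sqrt_le_iff.mpr ⟨by positivity, ?_⟩)
  rcases Nat.eq_zero_or_pos d with h0 | h0
  · simp [h0]
  · have : (1 : ℝ) ≤ d := by exact_mod_cast h0
    nlinarith

/-- The unit cell with lower corner `k`. -/
def latCell (k : Fin d → ℤ) : Set (EuclideanSpace ℝ (Fin d)) := {x | latFloor x = k}

theorem latCell_eq (k : Fin d → ℤ) : latCell k = WithLp.ofLp ⁻¹'
    (Set.univ.pi fun j => Set.Ico (k j : ℝ) (k j + 1)) := by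
  ext x
  simp [latCell, latFloor, funext_iff, Int.floor_eq_iff]

theorem measurableSet_latCell (k : Fin d → ℤ) : MeasurableSet (latCell k) := by
  rw [latCell_eq]
  exact (PiLp.volume_preserving_ofLp (Fin d)).measurable
    (MeasurableSet.univ_pi fun _ => measurableSet_Ico)

theorem volume_latCell (k : Fin d → ℤ) : volume (latCell k) = 1 := by
  rw [latCell_eq, (PiLp.volume_preserving_ofLp (Fin d)).measure_preimage
    (MeasurableSet.univ_pi fun _ => measurableSet_Ico).nullMeasurableSet, Real.volume_pi_Ico]
  simp

theorem integrable_latCell_const (k : Fin d → ℤ) (c : ℝ) :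
    Integrable (Set.indicator (latCell k) fun _ => c) :=
  (integrable_indicator_iff (measurableSet_latCell k)).mpr
    (integrableOn_const (by simp [volume_latCell]))

theorem integral_latCell_const (k : Fin d → ℤ) (c : ℝ) :
    ∫ x, Set.indicator (latCell k) (fun _ => c) x = c := by
  rw [integral_indicator (measurableSet_latCell k), setIntegral_const]
  simp [Measure.real, volume_latCell]

theorem sum_latCell_indicator {N : ℕ} (F : (Fin d → ℤ) → ℝ) (x : EuclideanSpace ℝ (Fin d)) :
    ∑ k ∈ latticeBall d N, Set.indicator (latCell k) (fun _ => F k) x =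
      if latFloor x ∈ latticeBall d N then F (latFloor x) else 0 := by
  classical
  simp only [Set.indicator_apply, latCell, Set.mem_ofPred_eq]
  rw [Finset.sum_ite_eq]

theorem one_le_norm_latVec {k : Fin d → ℤ} (hk : k ≠ 0) : 1 ≤ ‖latVec k‖ := by
  obtain ⟨j, hj⟩ := Function.ne_iff.mp hk
  have h1 : (1 : ℝ) ≤ |(k j : ℝ)| := by
    rw [← Int.cast_abs]; exact_mod_cast Int.one_le_abs hj
  exact h1.trans (abs_apply_le_norm (latVec k) j)

/-- A discrete cube of side m + 1 fits in the ball. It is shifted by one in direction p to avoid the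
origin, and its points have ℓ¹ norm at most d m + 1. -/
theorem card_latticeBall_ge (p : Fin d) {N : ℕ} (hN : 1 ≤ N) :
    ((N : ℝ) / d) ^ d ≤ (latticeBall d N).card := by
  have hd : 0 < d := p.pos
  -- Natural-number division is arranged so that d m + 1 ≤ N ≤ d (m + 1).
  set m := (N - 1) / d with hm
  have hm1 : d * m ≤ N - 1 := Nat.mul_div_le _ _
  have hm2 : N ≤ d * (m + 1) := by
    have := Nat.lt_mul_div_succ (N - 1) hd
    rw [← hm] at this
    omega
  let e : (Fin d → Fin (m + 1)) → (Fin d → ℤ) := fun c j => (c j : ℤ) + if j = p then 1 else 0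
  have he : Function.Injective e := fun c c' h => by
    funext j
    have := congrFun h j
    simp only [e, add_left_inj, Nat.cast_inj] at this
    exact Fin.ext this
  have hmem : ∀ c, e c ∈ latticeBall d N := fun c => by
    rw [mem_latticeBall]
    constructor
    · refine one_le_norm_latVec fun h => ?_
      have := congrFun h p
      simp only [e, if_true, Pi.zero_apply] at this
      omega
    · have h0 : ‖latVec (e c)‖ ≤ ∑ j, |(e c j : ℝ)| := by
        rw [EuclideanSpace.norm_eq]
        refine Real.sqrt_le_iff.mpr ⟨Finset.sum_nonneg fun _ _ => abs_nonneg _, ?_⟩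
        simp only [latVec_apply, Real.norm_eq_abs]
        exact Finset.sum_sq_le_sq_sum_of_nonneg fun _ _ => abs_nonneg _
      refine h0.trans ?_
      have h1 : ∀ j, |(e c j : ℝ)| ≤ (m : ℝ) + if j = p then 1 else 0 := fun j => by
        have : ((c j : ℕ) : ℝ) ≤ m := by exact_mod_cast Nat.lt_succ_iff.mp (c j).2
        simp only [e]
        split_ifs <;> push_cast <;> rw [abs_of_nonneg (by positivity)] <;> linarith
      refine (Finset.sum_le_sum fun j _ => h1 j).trans ?_
      rw [Finset.sum_add_distrib]
      simp only [Finset.sum_const, Finset.card_univ, Fintype.card_fin, nsmul_eq_mul,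
        Finset.sum_ite_eq', Finset.mem_univ, if_true]
      have : d * m + 1 ≤ N := by omega
      exact_mod_cast this
  have hcard : (m + 1) ^ d ≤ (latticeBall d N).card := by
    have := Finset.card_le_card_of_injOn (s := Finset.univ) e (fun c _ => hmem c) he.injOn
    simpa using this
  calc ((N : ℝ) / d) ^ d ≤ ((m : ℝ) + 1) ^ d := by
        refine pow_le_pow_left₀ (by positivity) ?_ d
        rw [div_le_iff₀ (by exact_mod_cast hd), mul_comm]
        exact_mod_cast hm2
    _ ≤ _ := by exact_mod_cast hcard

theorem rpow_neg_sub_one_mul_card_le {N : ℕ} {s : ℝ} (hs : 0 < s) :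
    ((latticeBall d N).card : ℝ) * (N : ℝ) ^ (-s - 1) ≤
      ∑ k ∈ latticeBall d N, ‖latVec k‖ ^ (-s - 1) := by
  rw [← nsmul_eq_mul]
  refine Finset.card_nsmul_le_sum _ _ _ fun k hk => ?_
  rw [mem_latticeBall] at hk
  exact Real.rpow_le_rpow_of_nonpos (by linarith) hk.2 (by linarith)

/-- The contribution of the boundary of the ball of radius `N` is dominated by the bulk sum. -/
theorem rpow_boundary_le (p : Fin d) {N : ℕ} (hN : 1 ≤ N) {s : ℝ} (hs : 0 < s) :
    (N : ℝ) ^ (d - 1) * (N : ℝ) ^ (-s) ≤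
      (d : ℝ) ^ d * ∑ k ∈ latticeBall d N, ‖latVec k‖ ^ (-s - 1) := by
  have hN0 : (0 : ℝ) < N := by exact_mod_cast hN
  have hd : 0 < d := p.pos
  have hd0 : (0 : ℝ) < d := by exact_mod_cast hd
  have h1 := rpow_neg_sub_one_mul_card_le (d := d) (N := N) hs
  have h2 := card_latticeBall_ge p hN
  have h3 : (N : ℝ) ^ (-s - 1) = (N : ℝ) ^ (-s) / N := Real.rpow_sub_one hN0.ne' _
  have h4 : (N : ℝ) ^ (d - 1) * N = (N : ℝ) ^ d := by
    rw [← pow_succ, Nat.sub_add_cancel hd]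
  -- The ball contains at least (N/d)^d points, each with summand at least N^(-s-1), so no
  -- asymptotics of the sum are needed.
  calc (N : ℝ) ^ (d - 1) * (N : ℝ) ^ (-s)
      = (d : ℝ) ^ d * (((N : ℝ) / d) ^ d * (N : ℝ) ^ (-s - 1)) := by
        rw [h3, div_pow, ← h4]; field_simp
    _ ≤ (d : ℝ) ^ d * ((latticeBall d N).card * (N : ℝ) ^ (-s - 1)) := by gcongr
    _ ≤ _ := by gcongr

/-- A coordinate vector already contributes 1. This lets bounded errors be absorbed into the sum. -/
theorem one_le_sum_rpow (p : Fin d) {N : ℕ} (hN : 1 ≤ N) (s : ℝ) :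
    1 ≤ ∑ k ∈ latticeBall d N, ‖latVec k‖ ^ s := by
  have h0 : ‖latVec (Pi.single p (1 : ℤ) : Fin d → ℤ)‖ = 1 := by
    rw [← pow_left_inj₀ (norm_nonneg _) zero_le_one two_ne_zero, norm_latVec_sq]
    rw [Finset.sum_eq_single p] <;> simp +contextual
  have hm : (Pi.single p (1 : ℤ) : Fin d → ℤ) ∈ latticeBall d N := by
    rw [mem_latticeBall, h0]
    exact ⟨le_rfl, by exact_mod_cast hN⟩
  have := Finset.single_le_sum (f := fun k => ‖latVec k‖ ^ s)
    (fun k _ => Real.rpow_nonneg (norm_nonneg _) _) hm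
  simpa [h0] using this

/-- By scaling, the volume is that of the unit ball times R^d - r^d. A shell of bounded width thus
has volume of order R^(d-1). -/
theorem volume_real_annulus_le (p : Fin d) {r R : ℝ} (hr : 0 ≤ r) (hrR : r ≤ R) :
    volume.real (Metric.closedBall (0 : EuclideanSpace ℝ (Fin d)) R \ Metric.ball 0 r) ≤
      volume.real (Metric.closedBall (0 : EuclideanSpace ℝ (Fin d)) 1) *
        ((R - r) * d * R ^ (d - 1)) := by
  have : Nonempty (Fin d) := ⟨p⟩
  have hR := hr.trans hrR
  rw [measureReal_sdiff (Metric.ball_subset_closedBall.trans (Metric.closedBall_subset_closedBall hrR))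
    measurableSet_ball measure_closedBall_lt_top.ne,
    ← Measure.addHaar_real_closedBall_eq_addHaar_real_ball,
    Measure.addHaar_real_closedBall' _ _ hr, Measure.addHaar_real_closedBall' _ _ hR, ← sub_mul,
    mul_comm]
  refine mul_le_mul_of_nonneg_left ?_ measureReal_nonneg
  have h := abs_pow_sub_pow_le R r (Module.finrank ℝ (EuclideanSpace ℝ (Fin d)))
  rw [abs_of_nonneg (sub_nonneg.mpr hrR), abs_of_nonneg hr, abs_of_nonneg hR, max_eq_left hrR,
    finrank_euclideanSpace_fin] at h
  rw [finrank_euclideanSpace_fin]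
  exact (le_abs_self _).trans h

/-- Pointwise comparison of the lattice function with the profile cut off to an annulus. -/
theorem abs_latticeStep_sub_le (p q : Fin d) {s : ℝ} (hs : 0 < s) {N : ℕ} (hN : 2 * d ≤ N)
    (x : EuclideanSpace ℝ (Fin d)) :
    |(∑ k ∈ latticeBall d N,
        Set.indicator (latCell k) (fun _ => quarticProfile p q s (latVec k)) x) -
      Set.indicator {x | 1 ≤ ‖x‖ ∧ ‖x‖ ≤ (N : ℝ)} (quarticProfile p q s) x| ≤
    (∑ k ∈ latticeBall d N, Set.indicator (latCell k) (fun _ =>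
        (8 * s * (1 + d) ^ (s + 1) * d + 64 * d) * ‖latVec k‖ ^ (-s - 1)) x) +
      (Set.indicator (Metric.closedBall 0 d) (fun _ => 8) x +
        Set.indicator (Metric.closedBall 0 (N + d) \ Metric.ball 0 (N - d))
          (fun _ => 8 * ((N : ℝ) / 2) ^ (-s)) x) := by
  classical
  have hd : (1 : ℝ) ≤ d := by exact_mod_cast p.pos
  have hN' : 2 * (d : ℝ) ≤ N := by exact_mod_cast hN
  rw [sum_latCell_indicator (fun k => quarticProfile p q s (latVec k)),
    sum_latCell_indicator (fun k =>
      (8 * s * (1 + d) ^ (s + 1) * d + 64 * d) * ‖latVec k‖ ^ (-s - 1))]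
  have hK := norm_sub_latFloor_le x
  set K := latFloor x
  have hK1 : ‖x‖ ≤ ‖latVec K‖ + d := by
    have := norm_sub_norm_le x (latVec K); linarith
  have hK2 : ‖latVec K‖ ≤ ‖x‖ + d := by
    have := norm_sub_norm_le (latVec K) x; rw [norm_sub_rev] at this; linarith
  have hI1 : 0 ≤ Set.indicator (Metric.closedBall (0 : EuclideanSpace ℝ (Fin d)) d)
      (fun _ => (8 : ℝ)) x := Set.indicator_nonneg (fun _ _ => by norm_num) x
  have hI2 : 0 ≤ Set.indicator
      (Metric.closedBall (0 : EuclideanSpace ℝ (Fin d)) (N + d) \ Metric.ball 0 (N - d))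
      (fun _ => 8 * ((N : ℝ) / 2) ^ (-s)) x :=
    Set.indicator_nonneg (fun _ _ => by positivity) x
  have inner : ‖x‖ ≤ d → Set.indicator (Metric.closedBall (0 : EuclideanSpace ℝ (Fin d)) d)
      (fun _ => (8 : ℝ)) x = 8 := fun h => Set.indicator_of_mem (by simpa using h) _
  have outer : (N : ℝ) - d ≤ ‖x‖ → ‖x‖ ≤ N + d → Set.indicator
      (Metric.closedBall (0 : EuclideanSpace ℝ (Fin d)) (N + d) \ Metric.ball 0 (N - d))
      (fun _ => 8 * ((N : ℝ) / 2) ^ (-s)) x = 8 * ((N : ℝ) / 2) ^ (-s) := fun h h' =>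
    Set.indicator_of_mem (Set.mem_sdiff_of_mem (by simpa using h') (by simpa using h)) _
  have small : ∀ y : EuclideanSpace ℝ (Fin d), 1 ≤ ‖y‖ → |quarticProfile p q s y| ≤ 8 :=
    fun y hy => (abs_quarticProfile_le p q s y).trans (by
      have := Real.rpow_le_one_of_one_le_of_nonpos hy (by linarith : -s ≤ 0)
      linarith)
  -- Near the outer sphere norms are at least N - d, which is at least N/2 because 2d ≤ N.
  have large : ∀ y : EuclideanSpace ℝ (Fin d), (N : ℝ) / 2 ≤ ‖y‖ →
      |quarticProfile p q s y| ≤ 8 * ((N : ℝ) / 2) ^ (-s) := fun y hy =>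
    (abs_quarticProfile_le p q s y).trans (by
      have := Real.rpow_le_rpow_of_nonpos (by linarith : (0 : ℝ) < N / 2) hy
        (by linarith : -s ≤ 0)
      linarith)
  -- If both x and its lattice floor lie in the region, the oscillation bound applies. If exactly
  -- one does, then x is within d of the origin or its norm is within d of N, and one of the last
  -- two indicators pays.
  by_cases hKb : K ∈ latticeBall d N
  · have hKb' := (mem_latticeBall K).mp hKb
    rw [if_pos hKb, if_pos hKb]
    by_cases hx : 1 ≤ ‖x‖ ∧ ‖x‖ ≤ (N : ℝ)
    · rw [Set.indicator_of_mem (by exact hx)]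
      rw [abs_sub_comm]
      have := abs_quarticProfile_sub_le p q hs (by linarith) hx.1 hKb'.1 hK
      linarith
    · rw [Set.indicator_of_notMem (by exact hx), sub_zero]
      have h0 : 0 ≤ (8 * s * (1 + d : ℝ) ^ (s + 1) * d + 64 * d) * ‖latVec K‖ ^ (-s - 1) := by
        positivity
      by_cases h1 : 1 ≤ ‖x‖
      · have h2 : (N : ℝ) < ‖x‖ := by
          by_contra h; exact hx ⟨h1, not_lt.mp h⟩
        rw [outer (by linarith) (by linarith [hKb'.2])]
        have := large (latVec K) (by linarith)
        linarith
      · rw [inner (by linarith)]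
        have := small _ hKb'.1
        linarith
  · rw [if_neg hKb, if_neg hKb]
    by_cases hx : 1 ≤ ‖x‖ ∧ ‖x‖ ≤ (N : ℝ)
    · rw [Set.indicator_of_mem (by exact hx), zero_sub, abs_neg]
      by_cases h0 : K = 0
      · have hz : ‖latVec K‖ = 0 := by
          rw [← sq_eq_zero_iff, norm_latVec_sq, h0]; simp
        rw [inner (by linarith)]
        have := small x hx.1
        linarith
      · have h1 : (N : ℝ) < ‖latVec K‖ := by
          by_contra h
          exact hKb ((mem_latticeBall K).mpr ⟨one_le_norm_latVec h0, not_lt.mp h⟩)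
        rw [outer (by linarith) (by linarith [hx.2])]
        have := large x (by linarith)
        linarith
    · rw [Set.indicator_of_notMem (by exact hx), sub_zero, abs_zero]
      linarith

/-- The cells have unit volume, so the sum is the integral of a step function. Subtracting the
annulus integral, which is zero, allows the pointwise comparison to be integrated. -/
theorem abs_sum_quarticProfile_le_of_large {p q : Fin d} (hpq : p ≠ q) {s : ℝ} (hs : 0 < s)
    {N : ℕ} (hN : 2 * d ≤ N) :
    |∑ k ∈ latticeBall d N, quarticProfile p q s (latVec k)| ≤
      (8 * s * (1 + d) ^ (s + 1) * d + 64 * d) * ∑ k ∈ latticeBall d N, ‖latVec k‖ ^ (-s - 1) +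
        (8 * volume.real (Metric.closedBall (0 : EuclideanSpace ℝ (Fin d)) d) +
        volume.real (Metric.closedBall (0 : EuclideanSpace ℝ (Fin d)) (N + d) \
          Metric.ball 0 (N - d)) * (8 * ((N : ℝ) / 2) ^ (-s))) := by
  have hm : MeasurableSet {x : EuclideanSpace ℝ (Fin d) | 1 ≤ ‖x‖ ∧ ‖x‖ ≤ (N : ℝ)} :=
    (measurableSet_le measurable_const measurable_norm).inter
      (measurableSet_le measurable_norm measurable_const)
  have hfin : volume {x : EuclideanSpace ℝ (Fin d) | 1 ≤ ‖x‖ ∧ ‖x‖ ≤ (N : ℝ)} ≠ ⊤ := by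
    refine ((measure_mono ?_).trans_lt
      (measure_closedBall_lt_top (x := (0 : EuclideanSpace ℝ (Fin d))) (r := (N : ℝ)))).ne
    intro x hx
    simpa using hx.2
  have hW : Integrable (Set.indicator {x : EuclideanSpace ℝ (Fin d) | 1 ≤ ‖x‖ ∧ ‖x‖ ≤ (N : ℝ)}
      (quarticProfile p q s)) := by
    rw [integrable_indicator_iff hm]
    refine Measure.integrableOn_of_bounded (M := 8) hfin
      (measurable_quarticProfile p q s).aestronglyMeasurable ?_
    refine (ae_restrict_iff' hm).mpr (Filter.Eventually.of_forall fun x hx => ?_)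
    have := Real.rpow_le_one_of_one_le_of_nonpos hx.1 (by linarith : -s ≤ 0)
    exact (abs_quarticProfile_le p q s x).trans (by linarith)
  have hS : ∀ F : (Fin d → ℤ) → ℝ, Integrable fun x => ∑ k ∈ latticeBall d N,
      Set.indicator (latCell k) (fun _ => F k) x := fun F =>
    integrable_finsetSum _ fun k _ => integrable_latCell_const k (F k)
  have hSi : ∀ F : (Fin d → ℤ) → ℝ, ∫ x, ∑ k ∈ latticeBall d N,
      Set.indicator (latCell k) (fun _ => F k) x = ∑ k ∈ latticeBall d N, F k := fun F => by
    rw [integral_finsetSum _ fun k _ => integrable_latCell_const k (F k)]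
    exact Finset.sum_congr rfl fun k _ => integral_latCell_const k _
  have hA : MeasurableSet (Metric.closedBall (0 : EuclideanSpace ℝ (Fin d)) (N + d) \
      Metric.ball 0 (N - d)) := measurableSet_closedBall.diff measurableSet_ball
  have hB : ∀ c : ℝ, Integrable
      (Set.indicator (Metric.closedBall (0 : EuclideanSpace ℝ (Fin d)) d) (fun _ => c)) :=
    fun c => (integrable_indicator_iff measurableSet_closedBall).mpr
      (integrableOn_const measure_closedBall_lt_top.ne)
  have hC : ∀ c : ℝ, Integrable (Set.indicator
      (Metric.closedBall (0 : EuclideanSpace ℝ (Fin d)) (N + d) \ Metric.ball 0 (N - d))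
        (fun _ => c)) := fun c => (integrable_indicator_iff hA).mpr
      (integrableOn_const
        ((measure_mono Set.sdiff_subset).trans_lt measure_closedBall_lt_top).ne)
  have h1 : ∑ k ∈ latticeBall d N, quarticProfile p q s (latVec k) =
      ∫ x, ((∑ k ∈ latticeBall d N,
        Set.indicator (latCell k) (fun _ => quarticProfile p q s (latVec k)) x) -
      Set.indicator {x | 1 ≤ ‖x‖ ∧ ‖x‖ ≤ (N : ℝ)} (quarticProfile p q s) x) := by
    rw [integral_sub (hS fun k => quarticProfile p q s (latVec k)) hW,
      hSi fun k => quarticProfile p q s (latVec k), integral_quarticProfile hpq, sub_zero]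
  rw [h1]
  refine (abs_integral_le_integral_abs).trans ?_
  refine (integral_mono_of_nonneg (Filter.Eventually.of_forall fun _ => abs_nonneg _)
    (((hS fun k => (8 * s * (1 + d) ^ (s + 1) * d + 64 * d) * ‖latVec k‖ ^ (-s - 1)).add
      ((hB 8).add (hC (8 * ((N : ℝ) / 2) ^ (-s))))))
    (Filter.Eventually.of_forall (abs_latticeStep_sub_le p q hs hN))).trans ?_
  refine le_of_eq ?_
  rw [integral_add' (hS fun k => (8 * s * (1 + d) ^ (s + 1) * d + 64 * d) *
      ‖latVec k‖ ^ (-s - 1)) ((hB 8).add (hC (8 * ((N : ℝ) / 2) ^ (-s)))),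
    integral_add' (hB 8) (hC _),
    hSi fun k => (8 * s * (1 + d) ^ (s + 1) * d + 64 * d) * ‖latVec k‖ ^ (-s - 1),
    integral_indicator measurableSet_closedBall, integral_indicator hA, setIntegral_const,
    setIntegral_const, ← Finset.mul_sum]
  simp only [smul_eq_mul]
  ring

/-- The weighted lattice sum of the quartic harmonic is of lower order. -/
theorem exists_abs_sum_quarticProfile_le {p q : Fin d} (hpq : p ≠ q) {s : ℝ} (hs : 0 < s) :
    ∃ C : ℝ, 0 < C ∧ ∀ N : ℕ, 1 ≤ N →
      |∑ k ∈ latticeBall d N, quarticProfile p q s (latVec k)| ≤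
        C * ∑ k ∈ latticeBall d N, ‖latVec k‖ ^ (-s - 1) := by
  have hd : (1 : ℝ) ≤ d := by exact_mod_cast p.pos
  set V1 := volume.real (Metric.closedBall (0 : EuclideanSpace ℝ (Fin d)) 1)
  set Vd := volume.real (Metric.closedBall (0 : EuclideanSpace ℝ (Fin d)) d)
  have hV1 : 0 ≤ V1 := measureReal_nonneg
  have hVd : 0 ≤ Vd := measureReal_nonneg
  set C1 : ℝ := 8 * s * (1 + d) ^ (s + 1) * d + 64 * d with hC1
  set C2 : ℝ := V1 * (2 * d * d * 2 ^ (d - 1)) * (8 * 2 ^ s) with hC2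
  have hC1p : 0 < C1 := by positivity
  have hC2p : 0 ≤ C2 := by positivity
  -- The four terms pay for small N, oscillation within cells, the region near the origin, and the
  -- outer shell.
  refine ⟨16 * d + C1 + 8 * Vd + C2 * (d : ℝ) ^ d, by positivity, fun N hN => ?_⟩
  have hN0 : (1 : ℝ) ≤ N := by exact_mod_cast hN
  have hS1 := one_le_sum_rpow p hN (-s - 1)
  have hS2 := rpow_boundary_le p hN hs
  set S := ∑ k ∈ latticeBall d N, ‖latVec k‖ ^ (-s - 1)
  by_cases h : 2 * d ≤ N
  · have hN' : 2 * (d : ℝ) ≤ N := by exact_mod_cast h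
    refine (abs_sum_quarticProfile_le_of_large hpq hs h).trans ?_
    have h1 := volume_real_annulus_le p (r := N - d) (R := N + d) (by linarith) (by linarith)
    have h2 : ((N : ℝ) + d) ^ (d - 1) ≤ 2 ^ (d - 1) * (N : ℝ) ^ (d - 1) := by
      rw [← mul_pow]
      exact pow_le_pow_left₀ (by linarith) (by linarith) _
    have h3 : ((N : ℝ) / 2) ^ (-s) = 2 ^ s * (N : ℝ) ^ (-s) := by
      rw [Real.div_rpow (by linarith) (by norm_num), Real.rpow_neg zero_le_two, div_inv_eq_mul,
        mul_comm]
    have h4 : volume.real (Metric.closedBall (0 : EuclideanSpace ℝ (Fin d)) (N + d) \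
        Metric.ball 0 (N - d)) * (8 * ((N : ℝ) / 2) ^ (-s)) ≤ C2 * ((d : ℝ) ^ d * S) := by
      calc _ ≤ (V1 * ((2 * d) * d * (2 ^ (d - 1) * (N : ℝ) ^ (d - 1)))) *
            (8 * (2 ^ s * (N : ℝ) ^ (-s))) := by
            rw [h3]
            refine mul_le_mul_of_nonneg_right (h1.trans ?_) (by positivity)
            rw [show (N : ℝ) + d - (N - d) = 2 * d by ring]
            gcongr
        _ = C2 * ((N : ℝ) ^ (d - 1) * (N : ℝ) ^ (-s)) := by rw [hC2]; ring
        _ ≤ _ := by gcongr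
    have h5 : 8 * Vd ≤ 8 * Vd * S := le_mul_of_one_le_right (by positivity) hS1
    have h6 : 0 ≤ 16 * d * S := by positivity
    calc _ ≤ C1 * S + (8 * Vd * S + C2 * ((d : ℝ) ^ d * S)) := by gcongr
      _ ≤ _ := by linarith
  -- For small N no cancellation is needed: |k| ≤ 2d gives 8|k|^(-s) ≤ 16 d |k|^(-s-1).
  · have hN' : (N : ℝ) ≤ 2 * d := by exact_mod_cast (not_le.mp h).le
    have h1 : |∑ k ∈ latticeBall d N, quarticProfile p q s (latVec k)| ≤ 16 * d * S := by
      refine (Finset.abs_sum_le_sum_abs _ _).trans ?_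
      rw [Finset.mul_sum]
      refine Finset.sum_le_sum fun k hk => ?_
      rw [mem_latticeBall] at hk
      refine (abs_quarticProfile_le p q s _).trans ?_
      have hk0 : 0 < ‖latVec k‖ := by linarith
      rw [Real.rpow_sub_one hk0.ne']
      calc 8 * ‖latVec k‖ ^ (-s) = 8 * ‖latVec k‖ * (‖latVec k‖ ^ (-s) / ‖latVec k‖) := by
            field_simp
        _ ≤ _ := mul_le_mul_of_nonneg_right (by linarith [hk.2]) (by positivity)
    have h2 : 0 ≤ (C1 + 8 * Vd + C2 * (d : ℝ) ^ d) * S := by positivity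
    refine h1.trans ?_
    linarith

/-! ### Complexified vectors and projections. -/

/-- The complexification of a real vector. -/
noncomputable def toComplexVec (x : EuclideanSpace ℝ (Fin d)) : EuclideanSpace ℂ (Fin d) :=
  WithLp.toLp 2 fun j => (x j : ℂ)

theorem toComplexVec_apply (x : EuclideanSpace ℝ (Fin d)) (j : Fin d) :
    toComplexVec x j = (x j : ℂ) := rfl

theorem norm_toComplexVec (x : EuclideanSpace ℝ (Fin d)) : ‖toComplexVec x‖ = ‖x‖ := by
  simp [EuclideanSpace.norm_eq, toComplexVec_apply]

theorem latVecC_eq (k : Fin d → ℤ) : latVecC k = toComplexVec (latVec k) := by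
  ext j
  simp [latVecC, toComplexVec_apply, latVec_apply]

/-- The bilinear pairing of a real and a complex vector. -/
noncomputable def realDot (x : EuclideanSpace ℝ (Fin d)) (w : EuclideanSpace ℂ (Fin d)) : ℂ :=
  ∑ j, (x j : ℂ) * w j

theorem latDot_eq (k : Fin d → ℤ) (w : EuclideanSpace ℂ (Fin d)) :
    latDot k w = realDot (latVec k) w := by
  simp [latDot, realDot, latVec_apply]

theorem norm_realDot_le (x : EuclideanSpace ℝ (Fin d)) (w : EuclideanSpace ℂ (Fin d)) :
    ‖realDot x w‖ ≤ ‖x‖ * ‖w‖ := by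
  have h : realDot x w = inner ℂ (toComplexVec x) w := by
    simp [realDot, PiLp.inner_apply, toComplexVec_apply, mul_comm]
  rw [h, ← norm_toComplexVec x]
  exact norm_inner_le_norm _ _

theorem realDot_sub_left (x y : EuclideanSpace ℝ (Fin d)) (w : EuclideanSpace ℂ (Fin d)) :
    realDot (x - y) w = realDot x w - realDot y w := by
  simp [realDot, sub_mul]

theorem realDot_smul_left (c : ℝ) (x : EuclideanSpace ℝ (Fin d)) (w : EuclideanSpace ℂ (Fin d)) :
    realDot (c • x) w = c * realDot x w := by
  simp [realDot, Finset.mul_sum, mul_assoc]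

theorem realDot_sub (x : EuclideanSpace ℝ (Fin d)) (w z : EuclideanSpace ℂ (Fin d)) :
    realDot x (w - z) = realDot x w - realDot x z := by
  simp [realDot, mul_sub]

theorem realDot_smul (x : EuclideanSpace ℝ (Fin d)) (c : ℂ) (w : EuclideanSpace ℂ (Fin d)) :
    realDot x (c • w) = c * realDot x w := by
  simp only [realDot, Finset.mul_sum, PiLp.smul_apply, smul_eq_mul]
  exact Finset.sum_congr rfl fun j _ => by ring

theorem realDot_toComplexVec (x y : EuclideanSpace ℝ (Fin d)) :
    realDot x (toComplexVec y) = ((inner ℝ x y : ℝ) : ℂ) := by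
  simp [realDot, PiLp.inner_apply, toComplexVec_apply, mul_comm]

theorem toComplexVec_sub (x y : EuclideanSpace ℝ (Fin d)) :
    toComplexVec (x - y) = toComplexVec x - toComplexVec y := by
  ext j; simp [toComplexVec_apply]

theorem toComplexVec_smul (c : ℝ) (x : EuclideanSpace ℝ (Fin d)) :
    toComplexVec (c • x) = (c : ℂ) • toComplexVec x := by
  ext j; simp [toComplexVec_apply]

theorem latVec_sub (k l : Fin d → ℤ) : latVec (k - l) = latVec k - latVec l := by
  ext j; simp [latVec_apply]

theorem latVec_neg (k : Fin d → ℤ) : latVec (-k) = -latVec k := by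
  ext j; simp [latVec_apply]

theorem latVec_ne_zero {k : Fin d → ℤ} (hk : k ≠ 0) : latVec k ≠ 0 :=
  norm_pos_iff.mp (zero_lt_one.trans_le (one_le_norm_latVec hk))

/-- The projection of a complex vector along a real vector `x`. -/
noncomputable def perpC (x : EuclideanSpace ℝ (Fin d)) (w : EuclideanSpace ℂ (Fin d)) :
    EuclideanSpace ℂ (Fin d) :=
  w - (realDot x w / ((‖x‖ ^ 2 : ℝ) : ℂ)) • toComplexVec x

theorem leray_apply {m : Fin d → ℤ} (hm : m ≠ 0) (u : FourierSeries d) :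
    leray u m = perpC (latVec m) (u m) := by
  simp [leray, hm, perpC, latDot_eq, latVecC_eq]

theorem leray_zero (u : FourierSeries d) : leray u 0 = 0 := by
  simp [leray]

theorem perpC_sub (x : EuclideanSpace ℝ (Fin d)) (w z : EuclideanSpace ℂ (Fin d)) :
    perpC x (w - z) = perpC x w - perpC x z := by
  simp only [perpC, realDot_sub, sub_div, sub_smul]
  abel

theorem perpC_smul (x : EuclideanSpace ℝ (Fin d)) (c : ℂ) (w : EuclideanSpace ℂ (Fin d)) :
    perpC x (c • w) = c • perpC x w := by
  simp only [perpC, realDot_smul, smul_sub, smul_smul, mul_div_assoc]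

theorem perpC_sum {ι : Type*} (s : Finset ι) (x : EuclideanSpace ℝ (Fin d))
    (f : ι → EuclideanSpace ℂ (Fin d)) : perpC x (∑ i ∈ s, f i) = ∑ i ∈ s, perpC x (f i) := by
  have h0 : perpC x 0 = 0 := by simpa using perpC_smul x 0 0
  have hadd : ∀ w z, perpC x (w + z) = perpC x w + perpC x z := fun w z => by
    have := perpC_sub x (w + z) z
    rw [add_sub_cancel_right] at this
    rw [this]
    abel
  induction s using Finset.cons_induction with
  | empty => simpa using h0
  | cons i s hi ih => rw [Finset.sum_cons, Finset.sum_cons, hadd, ih]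

theorem perpC_of_realDot_eq_zero {x : EuclideanSpace ℝ (Fin d)} {w : EuclideanSpace ℂ (Fin d)}
    (h : realDot x w = 0) : perpC x w = w := by
  simp [perpC, h]

theorem norm_perpC_le (x : EuclideanSpace ℝ (Fin d)) (w : EuclideanSpace ℂ (Fin d)) :
    ‖perpC x w‖ ≤ 2 * ‖w‖ := by
  rcases eq_or_ne x 0 with rfl | hx
  · simp only [perpC, norm_zero]
    simp
    linarith [norm_nonneg w]
  · have hx' := norm_pos_iff.mpr hx
    refine (norm_sub_le _ _).trans ?_
    rw [norm_smul, norm_toComplexVec, norm_div, Complex.norm_real, norm_pow, norm_norm]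
    have h := norm_realDot_le x w
    calc ‖w‖ + ‖realDot x w‖ / ‖x‖ ^ 2 * ‖x‖ ≤ ‖w‖ + ‖x‖ * ‖w‖ / ‖x‖ ^ 2 * ‖x‖ := by gcongr
      _ = 2 * ‖w‖ := by field_simp; ring

/-- The component of `k` orthogonal to `l`. -/
noncomputable def perpR (l k : EuclideanSpace ℝ (Fin d)) : EuclideanSpace ℝ (Fin d) :=
  k - (inner ℝ l k / ‖l‖ ^ 2) • l

theorem toComplexVec_perpR (l k : EuclideanSpace ℝ (Fin d)) :
    toComplexVec (perpR l k) = perpC l (toComplexVec k) := by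
  rw [perpR, perpC, toComplexVec_sub, toComplexVec_smul, realDot_toComplexVec]
  push_cast
  rfl

theorem perpR_self {l : EuclideanSpace ℝ (Fin d)} : perpR l l = 0 := by
  rcases eq_or_ne l 0 with rfl | h
  · simp [perpR]
  · rw [perpR, real_inner_self_eq_norm_sq, div_self (by simpa using h)]
    simp

theorem norm_perpR_sq (l k : EuclideanSpace ℝ (Fin d)) :
    ‖perpR l k‖ ^ 2 = ‖k‖ ^ 2 - inner ℝ l k ^ 2 / ‖l‖ ^ 2 := by
  rcases eq_or_ne l 0 with rfl | h
  · simp [perpR]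
  · have h' := norm_pos_iff.mpr h
    rw [perpR, norm_sub_sq_real, real_inner_smul_right, norm_smul, real_inner_comm, mul_pow,
      Real.norm_eq_abs, sq_abs]
    field_simp
    ring

theorem norm_perpR_le (l k : EuclideanSpace ℝ (Fin d)) : ‖perpR l k‖ ≤ ‖k‖ := by
  rw [← pow_le_pow_iff_left₀ (norm_nonneg _) (norm_nonneg _) two_ne_zero, norm_perpR_sq]
  have : 0 ≤ inner ℝ l k ^ 2 / ‖l‖ ^ 2 := by positivity
  linarith

/-- Projecting orthogonally to l kills l, so k may be replaced by k - l. With l = m this compensates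
the factor 1/|m-k|². -/
theorem norm_perpR_le_sub (l k : EuclideanSpace ℝ (Fin d)) : ‖perpR l k‖ ≤ ‖l - k‖ := by
  rcases eq_or_ne l 0 with rfl | h
  · simp [perpR]
  · have e : perpR l k = -perpR l (l - k) := by
      have h' : ‖l‖ ^ 2 ≠ 0 := by simpa using h
      rw [perpR, perpR, inner_sub_right, real_inner_self_eq_norm_sq, sub_div, div_self h', sub_smul,
        one_smul]
      abel
    rw [e, norm_neg]
    exact norm_perpR_le _ _

/-! ### The corrector as a Fourier multiplier. -/

/-- The symbol `|m|² sin² ∠(k, m)` of the noise covariance. -/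
noncomputable def sinSq (k m : EuclideanSpace ℝ (Fin d)) : ℝ := ‖m‖ ^ 2 - inner ℝ k m ^ 2 / ‖k‖ ^ 2

theorem sinSq_nonneg (k m : EuclideanSpace ℝ (Fin d)) : 0 ≤ sinSq k m := by
  rw [sinSq, ← norm_perpR_sq]; positivity

theorem sinSq_le (k m : EuclideanSpace ℝ (Fin d)) : sinSq k m ≤ ‖m‖ ^ 2 := by
  rw [sinSq]
  have : 0 ≤ inner ℝ k m ^ 2 / ‖k‖ ^ 2 := by positivity
  linarith

theorem IsNoiseFrame.inner_latVec {a : (Fin d → ℤ) → Fin (d - 1) → EuclideanSpace ℝ (Fin d)}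
    (ha : IsNoiseFrame a) {k : Fin d → ℤ} (hk : k ≠ 0) (i : Fin (d - 1)) :
    inner ℝ (latVec k) (a k i) = 0 := by
  have h : a k i ∈ (Submodule.span ℝ {latVec k})ᗮ := by
    rw [← ha.span_eq k hk]
    exact Submodule.subset_span ⟨i, rfl⟩
  exact Submodule.mem_orthogonal_singleton_iff_inner_right.mp h

/-- Parseval in k^⊥: both sides are the squared norm of the projection of m onto k^⊥. The choice of
frame disappears here. -/
theorem IsNoiseFrame.sum_inner_sq {a : (Fin d → ℤ) → Fin (d - 1) → EuclideanSpace ℝ (Fin d)}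
    (ha : IsNoiseFrame a) {k : Fin d → ℤ} (hk : k ≠ 0) (m : EuclideanSpace ℝ (Fin d)) :
    ∑ i, inner ℝ (a k i) m ^ 2 = sinSq (latVec k) m := by
  have hk0 : ‖latVec k‖ ^ 2 ≠ 0 := by simpa using latVec_ne_zero hk
  have hmem : perpR (latVec k) m ∈ Submodule.span ℝ (Set.range (a k)) := by
    rw [ha.span_eq k hk, Submodule.mem_orthogonal_singleton_iff_inner_right, perpR,
      inner_sub_right, real_inner_smul_right, real_inner_self_eq_norm_sq, div_mul_cancel₀ _ hk0,
      sub_self]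
  obtain ⟨c, hc⟩ := (Submodule.mem_span_range_iff_exists_fun ℝ).mp hmem
  have hc' : ∀ i, c i = inner ℝ (a k i) (perpR (latVec k) m) := fun i => by
    rw [← hc, (ha.orthonormal k hk).inner_right_fintype]
  have hi : ∀ i, inner ℝ (a k i) (perpR (latVec k) m) = inner ℝ (a k i) m := fun i => by
    rw [perpR, inner_sub_right, real_inner_smul_right, real_inner_comm _ (a k i),
      real_inner_comm (latVec k), ha.inner_latVec hk, mul_zero, sub_zero, real_inner_comm]
  rw [sinSq, ← norm_perpR_sq, ← real_inner_self_eq_norm_sq]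
  nth_rewrite 1 [← hc]
  rw [sum_inner]
  refine Finset.sum_congr rfl fun i _ => ?_
  rw [real_inner_smul_left, hc', hi]
  ring

theorem transport_apply (a : EuclideanSpace ℝ (Fin d)) (k : Fin d → ℤ) (u : FourierSeries d)
    (m : Fin d → ℤ) : transport a k u m =
      (2 * (Real.pi : ℂ) * Complex.I * ((inner ℝ a (latVec (m - k)) : ℝ) : ℂ)) • u (m - k) := by
  ext n
  simp only [transport, mulBasis, partialDeriv, Finset.sum_apply, Pi.smul_apply, PiLp.inner_apply,
    latVec_apply, WithLp.ofLp_sum, PiLp.smul_apply, smul_eq_mul, RCLike.inner_apply]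
  simp only [conj_trivial]
  push_cast
  rw [Finset.mul_sum, Finset.sum_mul]
  exact Finset.sum_congr rfl fun j _ => by simp; ring

theorem laplacian_apply (u : FourierSeries d) (m : Fin d → ℤ) :
    laplacian u m = ((-(4 * Real.pi ^ 2 * ‖latVec m‖ ^ 2) : ℝ) : ℂ) • u m := by
  ext n
  simp only [laplacian, partialDeriv, Finset.sum_apply, WithLp.ofLp_sum, PiLp.smul_apply,
    smul_eq_mul, norm_latVec_sq]
  push_cast
  rw [Finset.mul_sum, ← Finset.sum_neg_distrib, Finset.sum_mul]
  refine Finset.sum_congr rfl fun j _ => ?_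
  linear_combination (4 * (Real.pi : ℂ) ^ 2 * (m j : ℂ) ^ 2 * u m n) * Complex.I_sq

/-- The Fourier coefficient of a single term of the corrector. -/
theorem leray_transport_leray_transport {a : EuclideanSpace ℝ (Fin d)} {k m : Fin d → ℤ}
    (hm : m ≠ 0) (ha : inner ℝ a (latVec k) = 0) {u : FourierSeries d}
    (hu : IsDivFree u) :
    leray (transport a k (leray (transport a (-k) u))) m =
      ((-(4 * Real.pi ^ 2) * inner ℝ a (latVec m) ^ 2 : ℝ) : ℂ) •
        (u m - (realDot (latVec k) (u m) / ((‖latVec m - latVec k‖ ^ 2 : ℝ) : ℂ)) •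
          toComplexVec (perpR (latVec m) (latVec k))) := by
  have hdiv : realDot (latVec m) (u m) = 0 := by rw [← latDot_eq]; exact hu m hm
  have hmk : inner ℝ a (latVec (m - k)) = (inner ℝ a (latVec m) : ℝ) := by
    rw [latVec_sub, inner_sub_right, ha, sub_zero]
  rw [leray_apply hm, transport_apply, hmk]
  -- The inner projection drops the zero mode. When m = k the right side vanishes too, since a is
  -- orthogonal to k.
  by_cases h : m - k = 0
  · have : m = k := sub_eq_zero.mp h
    subst this
    simp [ha, perpC, realDot]
  · rw [leray_apply h, transport_apply, sub_neg_eq_add, sub_add_cancel, perpC_smul, perpC_smul,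
      perpC_smul, smul_smul]
    -- Since m·u(m) = 0, the pairing with m - k is -k·u(m); the outer projection then removes the
    -- component along m and leaves only P_m k.
    rw [show perpC (latVec (m - k)) (u m) = u m -
        (-(realDot (latVec k) (u m)) / ((‖latVec m - latVec k‖ ^ 2 : ℝ) : ℂ)) •
          (toComplexVec (latVec m) - toComplexVec (latVec k)) by
      rw [perpC, latVec_sub, realDot_sub_left, hdiv, zero_sub, toComplexVec_sub]]
    rw [perpC_sub, perpC_smul, perpC_sub, ← toComplexVec_perpR, ← toComplexVec_perpR, perpR_self,
      perpC_of_realDot_eq_zero hdiv]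
    have h0 : toComplexVec (0 : EuclideanSpace ℝ (Fin d)) = 0 := by
      ext j; simp [toComplexVec_apply]
    rw [h0, zero_sub, smul_neg, neg_div, neg_smul, neg_neg]
    congr 1
    push_cast
    linear_combination (4 * (Real.pi : ℂ) ^ 2 * ((inner ℝ a (latVec m) : ℝ) : ℂ) ^ 2) * Complex.I_sq

theorem thetaN_eq_zero {γ : ℝ} {N : ℕ} {k : Fin d → ℤ} (hk : k ∉ latticeBall d N) :
    thetaN d γ N k = 0 := by
  rw [mem_latticeBall] at hk
  simp [thetaN, hk]

theorem ne_zero_of_mem_latticeBall {N : ℕ} {k : Fin d → ℤ} (hk : k ∈ latticeBall d N) : k ≠ 0 := by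
  rintro rfl
  have h := ((mem_latticeBall _).mp hk).1
  have : ‖latVec (0 : Fin d → ℤ)‖ = 0 := by
    rw [← sq_eq_zero_iff, norm_latVec_sq]; simp
  linarith

theorem corrector_zero (a : (Fin d → ℤ) → Fin (d - 1) → EuclideanSpace ℝ (Fin d)) (κ : ℝ)
    (θ : (Fin d → ℤ) → ℝ) (u : FourierSeries d) : corrector a κ θ u 0 = 0 := by
  simp [corrector, leray_zero]

/-- The corrector is a Fourier multiplier on divergence free fields. -/
theorem corrector_apply {a : (Fin d → ℤ) → Fin (d - 1) → EuclideanSpace ℝ (Fin d)}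
    (ha : IsNoiseFrame a) (κ γ : ℝ) (N : ℕ) {u : FourierSeries d} (hu : IsDivFree u)
    {m : Fin d → ℤ} (hm : m ≠ 0) :
    corrector a κ (thetaN d γ N) u m = (((d : ℝ) / ((d : ℝ) - 1) * κ : ℝ) : ℂ) •
      ∑ k ∈ latticeBall d N,
        ((-(4 * Real.pi ^ 2) * (thetaN d γ N k ^ 2 * sinSq (latVec k) (latVec m)) : ℝ) : ℂ) •
        (u m - (realDot (latVec k) (u m) / ((‖latVec m - latVec k‖ ^ 2 : ℝ) : ℂ)) •
          toComplexVec (perpR (latVec m) (latVec k))) := by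
  classical
  unfold corrector
  congr 1
  set F : (Fin d → ℤ) → EuclideanSpace ℂ (Fin d) := fun k =>
    ∑ i : Fin (d - 1), ((thetaN d γ N k ^ 2 : ℝ) : ℂ) •
        leray (transport (a k i) k (leray (transport (a (-k) i) (-k) u))) m with hF
  have h1 : ∑' k : {k : Fin d → ℤ // k ≠ 0}, F k = ∑ k ∈ latticeBall d N, F k := by
    rw [← Finset.tsum_subtype' (latticeBall d N) F]
    refine (tsum_subtype {k : Fin d → ℤ | k ≠ 0} F).trans ?_
    rw [tsum_subtype]
    refine tsum_congr fun k => ?_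
    by_cases hk : k ∈ latticeBall d N
    · rw [Set.indicator_of_mem (by exact ne_zero_of_mem_latticeBall hk),
        Set.indicator_of_mem (by exact hk)]
    · rw [Set.indicator_of_notMem (s := (latticeBall d N : Set (Fin d → ℤ))) (by exact hk)]
      have : F k = 0 := by simp [hF, thetaN_eq_zero hk]
      simp [Set.indicator_apply, this]
  change ∑' k : {k : Fin d → ℤ // k ≠ 0}, F k = _
  rw [h1]
  refine Finset.sum_congr rfl fun k hk => ?_
  have hk0 := ne_zero_of_mem_latticeBall hk
  simp only [hF]
  rw [← ha.sum_inner_sq hk0, Finset.mul_sum, Finset.mul_sum, Complex.ofReal_sum, Finset.sum_smul]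
  refine Finset.sum_congr rfl fun i _ => ?_
  rw [ha.even k hk0, leray_transport_leray_transport hm
    (by rw [real_inner_comm]; exact ha.inner_latVec hk0 i) hu, smul_smul]
  congr 1
  push_cast
  ring

/-! ### Contraction of the moment tensors. -/

theorem inner_latVec_eq (k : Fin d → ℤ) (m : EuclideanSpace ℝ (Fin d)) :
    inner ℝ (latVec k) m = ∑ i, (k i : ℝ) * m i := by
  simp [PiLp.inner_apply, latVec_apply, mul_comm]

/-- Contraction of the second moments. -/
theorem sum_realDot_smul {N : ℕ} (φ : ℝ → ℝ) (w : EuclideanSpace ℂ (Fin d)) :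
    (d : ℂ) • ∑ k ∈ latticeBall d N, (φ ‖latVec k‖ : ℂ) • realDot (latVec k) w •
        toComplexVec (latVec k) =
      ((∑ k ∈ latticeBall d N, φ ‖latVec k‖ * ‖latVec k‖ ^ 2 : ℝ) : ℂ) • w := by
  ext n
  have h1 : (∑ k ∈ latticeBall d N, (φ ‖latVec k‖ : ℂ) • realDot (latVec k) w •
        toComplexVec (latVec k)) n = ∑ j, w j * (moment2 d N φ j n : ℂ) := by
    simp only [WithLp.ofLp_sum, Finset.sum_apply, PiLp.smul_apply, smul_eq_mul, realDot,
      toComplexVec_apply, latVec_apply, moment2, Complex.ofReal_sum, Finset.mul_sum,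
      Finset.sum_mul]
    rw [Finset.sum_comm]
    refine Finset.sum_congr rfl fun j _ => Finset.sum_congr rfl fun k _ => ?_
    push_cast
    ring
  have h2 : ∀ j, (d : ℂ) * (w j * (moment2 d N φ j n : ℂ)) = if j = n then
      ((∑ k ∈ latticeBall d N, φ ‖latVec k‖ * ‖latVec k‖ ^ 2 : ℝ) : ℂ) * w n else 0 := fun j => by
    have h := congrArg (fun x : ℝ => (x : ℂ) * w j) (moment2_eq (N := N) (φ := φ) j n)
    push_cast at h
    rw [show (d : ℂ) * (w j * (moment2 d N φ j n : ℂ)) = d * (moment2 d N φ j n : ℂ) * w j by ring, h]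
    split_ifs with hj
    · subst hj; push_cast; rfl
    · simp
  rw [PiLp.smul_apply, smul_eq_mul, h1, Finset.mul_sum, Finset.sum_congr rfl fun j _ => h2 j,
    PiLp.smul_apply, smul_eq_mul]
  simp

theorem sum_inner_sq {N : ℕ} (φ : ℝ → ℝ) (m : EuclideanSpace ℝ (Fin d)) :
    (d : ℝ) * ∑ k ∈ latticeBall d N, φ ‖latVec k‖ * inner ℝ (latVec k) m ^ 2 =
      (∑ k ∈ latticeBall d N, φ ‖latVec k‖ * ‖latVec k‖ ^ 2) * ‖m‖ ^ 2 := by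
  have h1 : ∑ k ∈ latticeBall d N, φ ‖latVec k‖ * inner ℝ (latVec k) m ^ 2 =
      ∑ i, ∑ j, m i * m j * moment2 d N φ i j := by
    have hk : ∀ k : Fin d → ℤ, φ ‖latVec k‖ * inner ℝ (latVec k) m ^ 2 =
        ∑ i, ∑ j, φ ‖latVec k‖ * (((k i : ℝ) * m i) * ((k j : ℝ) * m j)) := fun k => by
      simp only [← Finset.mul_sum, ← Finset.sum_mul, inner_latVec_eq, pow_two]
    simp only [hk, moment2, Finset.mul_sum]
    rw [Finset.sum_comm]
    refine Finset.sum_congr rfl fun i _ => ?_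
    rw [Finset.sum_comm]
    exact Finset.sum_congr rfl fun j _ => Finset.sum_congr rfl fun k _ => by ring
  have h2 : ∀ i j, (d : ℝ) * (m i * m j * moment2 d N φ i j) = m i * m j *
      if i = j then ∑ k ∈ latticeBall d N, φ ‖latVec k‖ * ‖latVec k‖ ^ 2 else 0 := fun i j => by
    rw [← moment2_eq]; ring
  simp only [h1, Finset.mul_sum, h2, EuclideanSpace.norm_sq_eq, Real.norm_eq_abs, sq_abs]
  refine Finset.sum_congr rfl fun i _ => ?_
  simp only [mul_ite, mul_zero, Finset.sum_ite_eq, Finset.mem_univ, if_true]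
  ring

/-- The componentwise product with the squares of the components of a real vector. -/
noncomputable def sqMul (m : EuclideanSpace ℝ (Fin d)) (w : EuclideanSpace ℂ (Fin d)) :
    EuclideanSpace ℂ (Fin d) :=
  WithLp.toLp 2 fun n => (m n : ℂ) ^ 2 * w n

theorem norm_sqMul_le (m : EuclideanSpace ℝ (Fin d)) (w : EuclideanSpace ℂ (Fin d)) :
    ‖sqMul m w‖ ≤ ‖m‖ ^ 2 * ‖w‖ := by
  rw [← pow_le_pow_iff_left₀ (norm_nonneg _) (by positivity) two_ne_zero, mul_pow,
    EuclideanSpace.norm_sq_eq, EuclideanSpace.norm_sq_eq w, Finset.mul_sum]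
  refine Finset.sum_le_sum fun n _ => ?_
  simp only [sqMul, norm_mul, norm_pow, Complex.norm_real, Real.norm_eq_abs, mul_pow]
  have := abs_apply_le_norm m n
  gcongr

/-- Contraction of the fourth moments. -/
theorem sum_inner_sq_realDot_smul {N : ℕ} (φ : ℝ → ℝ) {p q : Fin d} (hpq : p ≠ q)
    (m : EuclideanSpace ℝ (Fin d)) {w : EuclideanSpace ℂ (Fin d)} (hw : realDot m w = 0) :
    ∑ k ∈ latticeBall d N, (φ ‖latVec k‖ : ℂ) • ((inner ℝ (latVec k) m ^ 2 : ℝ) : ℂ) •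
        realDot (latVec k) w • toComplexVec (latVec k) =
      ((moment4 d N φ p p q q * ‖m‖ ^ 2 : ℝ) : ℂ) • w +
      ((moment4 d N φ p p p p - 3 * moment4 d N φ p p q q : ℝ) : ℂ) • sqMul m w := by
  ext n
  have h1 : (∑ k ∈ latticeBall d N, (φ ‖latVec k‖ : ℂ) • ((inner ℝ (latVec k) m ^ 2 : ℝ) : ℂ) •
        realDot (latVec k) w • toComplexVec (latVec k)) n =
      ∑ i, ∑ j, ∑ l, (m i : ℂ) * m j * w l * (moment4 d N φ i j l n : ℂ) := by
    have hk : ∀ k : Fin d → ℤ, (φ ‖latVec k‖ : ℂ) * (((inner ℝ (latVec k) m ^ 2 : ℝ) : ℂ) *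
        (realDot (latVec k) w * (k n : ℂ))) = ∑ i, ∑ j, ∑ l, (φ ‖latVec k‖ : ℂ) *
          (((k i : ℂ) * m i) * (((k j : ℂ) * m j) * (((k l : ℂ) * w l) * (k n : ℂ)))) := fun k => by
      simp only [← Finset.mul_sum, ← Finset.sum_mul, inner_latVec_eq, realDot, latVec_apply]
      push_cast
      ring
    simp only [WithLp.ofLp_sum, Finset.sum_apply, PiLp.smul_apply, smul_eq_mul,
      toComplexVec_apply, latVec_apply, Complex.ofReal_intCast, hk]
    rw [Finset.sum_comm]
    refine Finset.sum_congr rfl fun i _ => ?_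
    rw [Finset.sum_comm]
    refine Finset.sum_congr rfl fun j _ => ?_
    rw [Finset.sum_comm]
    refine Finset.sum_congr rfl fun l _ => ?_
    rw [moment4, Complex.ofReal_sum, Finset.mul_sum]
    refine Finset.sum_congr rfl fun k _ => ?_
    push_cast
    ring
  have hw' : ∑ j, (m j : ℂ) * w j = 0 := hw
  have hm : (‖m‖ : ℂ) ^ 2 = ∑ i, (m i : ℂ) * m i := by
    rw [← Complex.ofReal_pow, EuclideanSpace.norm_sq_eq]
    push_cast
    exact Finset.sum_congr rfl fun i _ => by
      rw [Real.norm_eq_abs, ← Complex.ofReal_pow, sq_abs]; push_cast; ring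
  rw [h1, PiLp.add_apply, PiLp.smul_apply, PiLp.smul_apply, smul_eq_mul, smul_eq_mul]
  set B := moment4 d N φ p p q q with hB
  set E := moment4 d N φ p p p p - 3 * B with hE
  have h2 : ∀ i j l, (m i : ℂ) * m j * w l * (moment4 d N φ i j l n : ℂ) =
      (B : ℂ) * ((if i = j then if l = n then (m i : ℂ) * m j * w l else 0 else 0) +
         (if i = l then if j = n then (m i : ℂ) * m j * w l else 0 else 0) +
         (if i = n then if j = l then (m i : ℂ) * m j * w l else 0 else 0)) +
      (E : ℂ) * (if i = j then if i = l then if i = n then (m i : ℂ) * m j * w l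
        else 0 else 0 else 0) := fun i j l => by
    rw [moment4_eq hpq i j l n, ← hB, ← hE]
    push_cast
    split_ifs <;> push_cast <;> ring
  simp only [h2, Finset.sum_add_distrib, ← Finset.mul_sum]
  have e1 : ∑ i, ∑ j, ∑ l, (if i = j then if l = n then (m i : ℂ) * m j * w l else 0 else 0) =
      (‖m‖ : ℂ) ^ 2 * w n := by
    rw [hm, Finset.sum_mul]
    refine Finset.sum_congr rfl fun i _ => ?_
    rw [Finset.sum_eq_single i (fun j _ hj => by simp [hj.symm]) (by simp)]
    simp
  -- This pairing and the next contract m with w, so the divergence-free condition removes them.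
  have e2 : ∑ i, ∑ j, ∑ l, (if i = l then if j = n then (m i : ℂ) * m j * w l else 0 else 0) =
      0 := by
    refine Eq.trans (b := (m n : ℂ) * ∑ j, (m j : ℂ) * w j) ?_ (by rw [hw', mul_zero])
    rw [Finset.mul_sum]
    refine Finset.sum_congr rfl fun i _ => ?_
    simp only [Finset.sum_ite_eq, Finset.mem_univ, if_true, Finset.sum_ite_eq']
    ring
  have e3 : ∑ i, ∑ j, ∑ l, (if i = n then if j = l then (m i : ℂ) * m j * w l else 0 else 0) =
      0 := by
    refine Eq.trans (b := (m n : ℂ) * ∑ j, (m j : ℂ) * w j) ?_ (by rw [hw', mul_zero])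
    rw [Finset.sum_eq_single n (fun i _ hi => by simp [hi]) (by simp), Finset.mul_sum]
    refine Finset.sum_congr rfl fun i _ => ?_
    simp only [if_true, Finset.sum_ite_eq, Finset.mem_univ]
    ring
  have e4 : ∑ i, ∑ j, ∑ l, (if i = j then if i = l then if i = n then (m i : ℂ) * m j * w l
        else 0 else 0 else 0) = (m n : ℂ) ^ 2 * w n := by
    rw [Finset.sum_eq_single n (fun i _ hi => by simp [hi]) (by simp),
      Finset.sum_eq_single n (fun i _ hi => by simp [hi.symm]) (by simp)]
    simp [pow_two]
  rw [e1, e2, e3, e4]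
  simp only [sqMul]
  push_cast
  ring

/-! ### The normalised noise weights. -/

theorem norm_latVec_pos {N : ℕ} {k : Fin d → ℤ} (hk : k ∈ latticeBall d N) : 0 < ‖latVec k‖ :=
  zero_lt_one.trans_le ((mem_latticeBall k).mp hk).1

theorem epsN_eq (γ : ℝ) (N : ℕ) :
    epsN d γ N = (∑ k ∈ latticeBall d N, ‖latVec k‖ ^ (-(2 * γ)))⁻¹ := by
  simp only [epsN, Real.rpow_neg (norm_nonneg _), one_div]

theorem epsN_nonneg (γ : ℝ) (N : ℕ) : 0 ≤ epsN d γ N := by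
  rw [epsN_eq]; positivity

theorem thetaN_sq {γ : ℝ} {N : ℕ} {k : Fin d → ℤ} (hk : k ∈ latticeBall d N) :
    thetaN d γ N k ^ 2 = epsN d γ N * ‖latVec k‖ ^ (-(2 * γ)) := by
  rw [thetaN, if_pos ((mem_latticeBall k).mp hk), mul_pow, Real.sq_sqrt (epsN_nonneg γ N),
    Real.rpow_neg (norm_nonneg _), mul_comm 2 γ, Real.rpow_mul (norm_nonneg _), Real.rpow_two,
    one_div, inv_pow]

theorem sum_thetaN_sq (p : Fin d) (γ : ℝ) {N : ℕ} (hN : 1 ≤ N) :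
    ∑ k ∈ latticeBall d N, thetaN d γ N k ^ 2 = 1 := by
  rw [Finset.sum_congr rfl fun k hk => thetaN_sq hk, ← Finset.mul_sum, epsN_eq]
  exact inv_mul_cancel₀ (zero_lt_one.trans_le (one_le_sum_rpow p hN _)).ne'

theorem decayN_eq (γ : ℝ) (N : ℕ) :
    decayN d γ N = epsN d γ N * ∑ k ∈ latticeBall d N, ‖latVec k‖ ^ (-(2 * γ) - 1) := by
  simp only [decayN, show -(2 * γ) - 1 = -(2 * γ + 1) by ring, Real.rpow_neg (norm_nonneg _),
    one_div]

theorem decayN_eq_sum (γ : ℝ) (N : ℕ) :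
    decayN d γ N = ∑ k ∈ latticeBall d N, thetaN d γ N k ^ 2 / ‖latVec k‖ := by
  rw [decayN_eq, Finset.mul_sum]
  refine Finset.sum_congr rfl fun k hk => ?_
  rw [thetaN_sq hk, Real.rpow_sub_one (norm_latVec_pos hk).ne', mul_div_assoc]

theorem decayN_nonneg (γ : ℝ) (N : ℕ) : 0 ≤ decayN d γ N := by
  rw [decayN_eq_sum]; positivity

theorem decayN_le_one (p : Fin d) (γ : ℝ) {N : ℕ} (hN : 1 ≤ N) : decayN d γ N ≤ 1 := by
  rw [decayN_eq_sum, ← sum_thetaN_sq p γ hN]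
  exact Finset.sum_le_sum fun k hk => div_le_self (sq_nonneg _) ((mem_latticeBall k).mp hk).1

/-- The radial weight `ε_N r^{-2γ-n}`. -/
noncomputable def radialWeight (d : ℕ) (γ : ℝ) (N n : ℕ) (r : ℝ) : ℝ :=
  epsN d γ N * r ^ (-(2 * γ)) / r ^ n

theorem radialWeight_latVec {γ : ℝ} {N : ℕ} (n : ℕ) {k : Fin d → ℤ} (hk : k ∈ latticeBall d N) :
    radialWeight d γ N n ‖latVec k‖ = thetaN d γ N k ^ 2 / ‖latVec k‖ ^ n := by
  rw [radialWeight, thetaN_sq hk]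

theorem sum_radialWeight_mul_pow (p : Fin d) (γ : ℝ) {N : ℕ} (hN : 1 ≤ N) (n : ℕ) :
    ∑ k ∈ latticeBall d N, radialWeight d γ N n ‖latVec k‖ * ‖latVec k‖ ^ n = 1 := by
  rw [← sum_thetaN_sq p γ hN]
  refine Finset.sum_congr rfl fun k hk => ?_
  rw [radialWeight_latVec n hk, div_mul_cancel₀ _ (pow_pos (norm_latVec_pos hk) n).ne']

/-- The defect of isotropy of the fourth moments of the noise. -/
noncomputable def anisotropy (γ : ℝ) (N : ℕ) (p q : Fin d) : ℝ :=
  moment4 d N (radialWeight d γ N 4) p p p p - 3 * moment4 d N (radialWeight d γ N 4) p p q q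

/-- By homogeneity the weight ε_N |k|^(-2γ-4) turns the quartic into the profile with s = 2γ, whose
error exponent -s - 1 is exactly that of D_N. -/
theorem exists_abs_anisotropy_le {p q : Fin d} (hpq : p ≠ q) {γ : ℝ} (hγ : 0 < γ) :
    ∃ C : ℝ, 0 < C ∧ ∀ N : ℕ, 1 ≤ N → |anisotropy γ N p q| ≤ C * decayN d γ N := by
  obtain ⟨C, hC, h⟩ := exists_abs_sum_quarticProfile_le hpq (by linarith : 0 < 2 * γ)
  refine ⟨C, hC, fun N hN => ?_⟩
  have h1 : 2 * anisotropy γ N p q =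
      epsN d γ N * ∑ k ∈ latticeBall d N, quarticProfile p q (2 * γ) (latVec k) := by
    rw [anisotropy, moment4_anisotropy, Finset.mul_sum]
    refine Finset.sum_congr rfl fun k hk => ?_
    have := norm_latVec_pos hk
    simp only [radialWeight, quarticProfile, quartic, PiLp.smul_apply, smul_eq_mul, latVec_apply]
    field_simp
  have h2 : 2 * |anisotropy γ N p q| ≤ C * decayN d γ N := by
    rw [← abs_two, ← abs_mul, h1, abs_mul, abs_of_nonneg (epsN_nonneg γ N), decayN_eq]
    calc _ ≤ epsN d γ N * (C * ∑ k ∈ latticeBall d N, ‖latVec k‖ ^ (-(2 * γ) - 1)) :=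
          mul_le_mul_of_nonneg_left (h N hN) (epsN_nonneg γ N)
      _ = _ := by ring
  linarith [abs_nonneg (anisotropy γ N p q)]

/-- The isotropic part of the second and fourth moments. -/
theorem moment4_pairs_eq {p q : Fin d} (hpq : p ≠ q) (γ : ℝ) {N : ℕ} (hN : 1 ≤ N) :
    (d : ℝ) * ((d + 2) * moment4 d N (radialWeight d γ N 4) p p q q + anisotropy γ N p q) = 1 := by
  rw [← sum_radialWeight_mul_pow p γ hN 4, ← moment4_trace hpq, anisotropy]
  ring

/-- Isotropy of the second moments gives cos² average 1/d, hence sin² average (d - 1)/d. -/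
theorem sum_thetaN_sq_mul_sinSq (p : Fin d) (γ : ℝ) {N : ℕ} (hN : 1 ≤ N)
    (m : EuclideanSpace ℝ (Fin d)) :
    (d : ℝ) * ∑ k ∈ latticeBall d N, thetaN d γ N k ^ 2 * sinSq (latVec k) m =
      (d - 1) * ‖m‖ ^ 2 := by
  have h1 := sum_inner_sq (N := N) (radialWeight d γ N 2) m
  rw [sum_radialWeight_mul_pow p γ hN 2] at h1
  have h2 : ∑ k ∈ latticeBall d N, thetaN d γ N k ^ 2 * sinSq (latVec k) m =
      ‖m‖ ^ 2 - ∑ k ∈ latticeBall d N,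
        radialWeight d γ N 2 ‖latVec k‖ * inner ℝ (latVec k) m ^ 2 := by
    rw [← one_mul (‖m‖ ^ 2), ← sum_thetaN_sq p γ hN, Finset.sum_mul, ← Finset.sum_sub_distrib]
    refine Finset.sum_congr rfl fun k hk => ?_
    rw [radialWeight_latVec 2 hk, sinSq]
    ring
  rw [h2, mul_sub, h1]
  ring

/-! ### Isotropic main term and shift error. -/

/-- The projection part of the multiplier with `|m - k|` replaced by `|k|`. -/
theorem sum_thetaN_sq_isotropic {p q : Fin d} (hpq : p ≠ q) (γ : ℝ) {N : ℕ} (hN : 1 ≤ N)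
    (m : EuclideanSpace ℝ (Fin d)) {w : EuclideanSpace ℂ (Fin d)} (hw : realDot m w = 0) :
    ∑ k ∈ latticeBall d N, ((thetaN d γ N k ^ 2 * sinSq (latVec k) m : ℝ) : ℂ) •
        (realDot (latVec k) w / ((‖latVec k‖ ^ 2 : ℝ) : ℂ)) • toComplexVec (perpR m (latVec k)) =
      ((‖m‖ ^ 2 * (1 / d - moment4 d N (radialWeight d γ N 4) p p q q) : ℝ) : ℂ) • w -
        ((anisotropy γ N p q : ℝ) : ℂ) • perpC m (sqMul m w) := by
  have hd : (d : ℂ) ≠ 0 := by exact_mod_cast p.pos.ne'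
  have h2 := sum_realDot_smul (N := N) (radialWeight d γ N 2) w
  rw [sum_radialWeight_mul_pow p γ hN 2, Complex.ofReal_one, one_smul] at h2
  replace h2 := congrArg (fun z => (d : ℂ)⁻¹ • z) h2
  simp only [smul_smul, inv_mul_cancel₀ hd, one_smul] at h2
  have h4 := sum_inner_sq_realDot_smul (N := N) (radialWeight d γ N 4) hpq m hw
  -- Splitting |m|² sin² as |m|² - (k·m)²/|k|² gives a second-moment contraction minus a
  -- fourth-moment one, with P_m taken outside the sum.
  have h : ∑ k ∈ latticeBall d N, ((thetaN d γ N k ^ 2 * sinSq (latVec k) m : ℝ) : ℂ) •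
        (realDot (latVec k) w / ((‖latVec k‖ ^ 2 : ℝ) : ℂ)) • toComplexVec (perpR m (latVec k)) =
      perpC m (((‖m‖ ^ 2 : ℝ) : ℂ) • ∑ k ∈ latticeBall d N,
        ((radialWeight d γ N 2 ‖latVec k‖ : ℂ) * realDot (latVec k) w) •
          toComplexVec (latVec k) -
        ∑ k ∈ latticeBall d N, (radialWeight d γ N 4 ‖latVec k‖ : ℂ) •
          ((inner ℝ (latVec k) m ^ 2 : ℝ) : ℂ) • realDot (latVec k) w •
            toComplexVec (latVec k)) := by
    rw [Finset.smul_sum, ← Finset.sum_sub_distrib, perpC_sum]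
    refine Finset.sum_congr rfl fun k hk => ?_
    rw [perpC_sub]
    simp only [perpC_smul, toComplexVec_perpR, smul_smul, ← sub_smul]
    congr 1
    have hk0 : (‖latVec k‖ : ℂ) ≠ 0 := by exact_mod_cast (norm_latVec_pos hk).ne'
    rw [radialWeight_latVec 2 hk, radialWeight_latVec 4 hk, sinSq]
    push_cast
    field_simp
  rw [h, h2, h4, ← sub_sub, perpC_sub, perpC_sub, perpC_smul, perpC_smul, perpC_smul, perpC_smul,
    perpC_of_realDot_eq_zero hw]
  congr 1
  rw [smul_smul, ← sub_smul]
  congr 1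
  push_cast
  field_simp

/-- Used with P = |P_m k|, a = |m-k|, b = |k|, c = |m|. The bound 1 holds because both quotients
P²/a² and P²/b² lie in [0,1]; the other factors b² - a² and uses P² ≤ ab and P² ≤ a². If a = 0, then
P = 0. -/
theorem sq_mul_abs_inv_sq_sub_le {P a b c : ℝ} (hP : 0 ≤ P) (hPa : P ≤ a) (hPb : P ≤ b)
    (hb : 0 < b) (hc : |b - a| ≤ c) :
    P ^ 2 * |1 / a ^ 2 - 1 / b ^ 2| ≤ min 1 (2 * c / b) := by
  have hc0 : 0 ≤ c := (abs_nonneg _).trans hc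
  rcases (hP.trans hPa).eq_or_lt with ha | ha
  · have : P = 0 := le_antisymm (ha ▸ hPa) hP
    rw [this]
    simp only [ne_eq, OfNat.ofNat_ne_zero, not_false_eq_true, zero_pow, zero_mul]
    exact le_min zero_le_one (by positivity)
  · refine le_min ?_ ?_
    · have e : P ^ 2 * |1 / a ^ 2 - 1 / b ^ 2| = |P ^ 2 / a ^ 2 - P ^ 2 / b ^ 2| := by
        rw [show P ^ 2 / a ^ 2 - P ^ 2 / b ^ 2 = P ^ 2 * (1 / a ^ 2 - 1 / b ^ 2) by ring, abs_mul,
          abs_of_nonneg (sq_nonneg P)]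
      rw [e]
      have h1 : P ^ 2 / a ^ 2 ≤ 1 := div_le_one_of_le₀ (by gcongr) (by positivity)
      have h2 : P ^ 2 / b ^ 2 ≤ 1 := div_le_one_of_le₀ (by gcongr) (by positivity)
      have h3 : 0 ≤ P ^ 2 / a ^ 2 := by positivity
      have h4 : 0 ≤ P ^ 2 / b ^ 2 := by positivity
      rw [abs_le]
      constructor <;> linarith
    · have e : 1 / a ^ 2 - 1 / b ^ 2 = (b - a) * ((a + b) / (a ^ 2 * b ^ 2)) := by
        field_simp; ring
      rw [e, abs_mul, abs_of_nonneg (by positivity : 0 ≤ (a + b) / (a ^ 2 * b ^ 2))]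
      have h1 : P ^ 2 ≤ a * b := by rw [pow_two]; gcongr
      have h2 : P ^ 2 ≤ a * a := by rw [pow_two]; gcongr
      have h3 : P ^ 2 * (a + b) ≤ 2 * (a ^ 2 * b) := by nlinarith
      calc P ^ 2 * (|b - a| * ((a + b) / (a ^ 2 * b ^ 2)))
          = |b - a| * (P ^ 2 * (a + b) / (a ^ 2 * b ^ 2)) := by ring
        _ ≤ c * (2 * (a ^ 2 * b) / (a ^ 2 * b ^ 2)) := by gcongr
        _ = 2 * c / b := by field_simp

/-- As w is orthogonal to m, its pairing with k sees only P_m k, which supplies the second factor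
|P_m k|. -/
theorem norm_realDot_smul_perpR_le (m k : EuclideanSpace ℝ (Fin d))
    {w : EuclideanSpace ℂ (Fin d)} (hw : realDot m w = 0) :
    ‖realDot k w‖ * ‖toComplexVec (perpR m k)‖ ≤ ‖perpR m k‖ ^ 2 * ‖w‖ := by
  have h : realDot k w = realDot (perpR m k) w := by
    rw [perpR, realDot_sub_left, realDot_smul_left, hw, mul_zero, sub_zero]
  rw [h, norm_toComplexVec]
  calc _ ≤ (‖perpR m k‖ * ‖w‖) * ‖perpR m k‖ := by gcongr; exact norm_realDot_le _ _
    _ = _ := by ring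

/-- The error of replacing `|m - k|` by `|k|` in the projection part of the multiplier. -/
theorem norm_sum_thetaN_sq_shift_le (p : Fin d) (γ : ℝ) {N : ℕ} (hN : 1 ≤ N)
    (m : EuclideanSpace ℝ (Fin d)) {w : EuclideanSpace ℂ (Fin d)} (hw : realDot m w = 0) :
    ‖∑ k ∈ latticeBall d N, ((thetaN d γ N k ^ 2 * sinSq (latVec k) m : ℝ) : ℂ) •
        (realDot (latVec k) w * ((1 / ‖m - latVec k‖ ^ 2 - 1 / ‖latVec k‖ ^ 2 : ℝ) : ℂ)) •
          toComplexVec (perpR m (latVec k))‖ ≤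
      2 * (‖m‖ ^ 2 * ‖w‖) * min 1 (‖m‖ * decayN d γ N) := by
  have hterm : ∀ k ∈ latticeBall d N,
      ‖((thetaN d γ N k ^ 2 * sinSq (latVec k) m : ℝ) : ℂ) •
        (realDot (latVec k) w * ((1 / ‖m - latVec k‖ ^ 2 - 1 / ‖latVec k‖ ^ 2 : ℝ) : ℂ)) •
          toComplexVec (perpR m (latVec k))‖ ≤
      (‖m‖ ^ 2 * ‖w‖) * (thetaN d γ N k ^ 2 * min 1 (2 * ‖m‖ / ‖latVec k‖)) := fun k hk => by
    have hs := sq_mul_abs_inv_sq_sub_le (norm_nonneg _) (norm_perpR_le_sub m (latVec k))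
      (norm_perpR_le m (latVec k)) (norm_latVec_pos hk) (c := ‖m‖) (by
        have := abs_norm_sub_norm_le (latVec k) (latVec k - m)
        rw [sub_sub_cancel] at this
        rwa [norm_sub_rev m])
    rw [norm_smul, norm_smul, norm_mul, Complex.norm_real, Complex.norm_real, Real.norm_eq_abs,
      Real.norm_eq_abs, abs_of_nonneg (mul_nonneg (sq_nonneg _) (sinSq_nonneg _ _))]
    have hb := norm_realDot_smul_perpR_le m (latVec k) hw
    calc thetaN d γ N k ^ 2 * sinSq (latVec k) m * (‖realDot (latVec k) w‖ *
          |1 / ‖m - latVec k‖ ^ 2 - 1 / ‖latVec k‖ ^ 2| * ‖toComplexVec (perpR m (latVec k))‖)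
        = thetaN d γ N k ^ 2 * (sinSq (latVec k) m * ((‖realDot (latVec k) w‖ *
          ‖toComplexVec (perpR m (latVec k))‖) *
            |1 / ‖m - latVec k‖ ^ 2 - 1 / ‖latVec k‖ ^ 2|)) := by ring
      _ ≤ thetaN d γ N k ^ 2 * (‖m‖ ^ 2 * ((‖perpR m (latVec k)‖ ^ 2 * ‖w‖) *
            |1 / ‖m - latVec k‖ ^ 2 - 1 / ‖latVec k‖ ^ 2|)) := by
          gcongr
          exact sinSq_le _ _
      _ = (‖m‖ ^ 2 * ‖w‖) * (thetaN d γ N k ^ 2 * (‖perpR m (latVec k)‖ ^ 2 *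
            |1 / ‖m - latVec k‖ ^ 2 - 1 / ‖latVec k‖ ^ 2|)) := by ring
      _ ≤ _ := by gcongr
  refine (norm_sum_le _ _).trans ((Finset.sum_le_sum hterm).trans ?_)
  rw [← Finset.mul_sum, mul_comm 2 (‖m‖ ^ 2 * ‖w‖), mul_assoc _ (2 : ℝ)]
  refine mul_le_mul_of_nonneg_left ?_ (by positivity)
  -- The two entries of the minimum use ∑ θ_k² = 1 and ∑ θ_k²/|k| = D_N respectively.
  rw [mul_min_of_nonneg _ _ zero_le_two]
  refine le_min ?_ ?_
  · calc _ ≤ ∑ k ∈ latticeBall d N, thetaN d γ N k ^ 2 := Finset.sum_le_sum fun k _ =>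
          mul_le_of_le_one_right (sq_nonneg _) (min_le_left _ _)
      _ ≤ _ := by rw [sum_thetaN_sq p γ hN]; norm_num
  · rw [decayN_eq_sum, Finset.mul_sum, Finset.mul_sum]
    refine Finset.sum_le_sum fun k _ => ?_
    calc _ ≤ thetaN d γ N k ^ 2 * (2 * ‖m‖ / ‖latVec k‖) := by
          gcongr; exact min_le_right _ _
      _ = _ := by ring

/-! ### Effective viscosity and the multiplier bound. -/

/-- The constant `C'_d`: it equals `1 / 4` for `d = 2` and `3 / 5` for `d = 3`. -/
noncomputable def effectiveViscosity (d : ℕ) : ℝ := 1 - ((d : ℝ) + 1) / (((d : ℝ) - 1) * (d + 2))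

/-- The difference of the corrector and its limit, as a Fourier multiplier. -/
theorem corrector_sub_laplacian_apply (hd : 2 ≤ d) {p q : Fin d} (hpq : p ≠ q)
    {a : (Fin d → ℤ) → Fin (d - 1) → EuclideanSpace ℝ (Fin d)}
    (ha : IsNoiseFrame a) (κ γ : ℝ) {N : ℕ} (hN : 1 ≤ N) {u : FourierSeries d} (hu : IsDivFree u)
    {m : Fin d → ℤ} (hm : m ≠ 0) :
    (corrector a κ (thetaN d γ N) u - ((effectiveViscosity d * κ : ℝ) : ℂ) • laplacian u) m =
      ((4 * Real.pi ^ 2 * κ * ((d : ℝ) / ((d : ℝ) - 1)) : ℝ) : ℂ) •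
      ((∑ k ∈ latticeBall d N, ((thetaN d γ N k ^ 2 * sinSq (latVec k) (latVec m) : ℝ) : ℂ) •
        (realDot (latVec k) (u m) *
          ((1 / ‖latVec m - latVec k‖ ^ 2 - 1 / ‖latVec k‖ ^ 2 : ℝ) : ℂ)) •
            toComplexVec (perpR (latVec m) (latVec k))) +
        ((anisotropy γ N p q : ℝ) : ℂ) • (((‖latVec m‖ ^ 2 / (d + 2) : ℝ) : ℂ) • u m -
          perpC (latVec m) (sqMul (latVec m) (u m)))) := by
  have hd' : (2 : ℝ) ≤ d := by exact_mod_cast hd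
  have hw : realDot (latVec m) (u m) = 0 := by rw [← latDot_eq]; exact hu m hm
  have hI := sum_thetaN_sq_isotropic hpq γ hN (latVec m) hw
  have hS := sum_thetaN_sq_mul_sinSq p γ hN (latVec m)
  have hB := moment4_pairs_eq hpq γ hN
  set B := moment4 d N (radialWeight d γ N 4) p p q q
  set E := anisotropy γ N p q
  set Y := ∑ k ∈ latticeBall d N, ((thetaN d γ N k ^ 2 * sinSq (latVec k) (latVec m) : ℝ) : ℂ) •
        (realDot (latVec k) (u m) *
          ((1 / ‖latVec m - latVec k‖ ^ 2 - 1 / ‖latVec k‖ ^ 2 : ℝ) : ℂ)) •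
            toComplexVec (perpR (latVec m) (latVec k)) with hY
  set M := ∑ k ∈ latticeBall d N, ((thetaN d γ N k ^ 2 * sinSq (latVec k) (latVec m) : ℝ) : ℂ) •
        (realDot (latVec k) (u m) / ((‖latVec k‖ ^ 2 : ℝ) : ℂ)) •
          toComplexVec (perpR (latVec m) (latVec k)) with hM
  set S := ∑ k ∈ latticeBall d N, thetaN d γ N k ^ 2 * sinSq (latVec k) (latVec m) with hSdef
  set Q := perpC (latVec m) (sqMul (latVec m) (u m))
  have hX : ∑ k ∈ latticeBall d N,
        ((-(4 * Real.pi ^ 2) * (thetaN d γ N k ^ 2 * sinSq (latVec k) (latVec m)) : ℝ) : ℂ) •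
        (u m - (realDot (latVec k) (u m) / ((‖latVec m - latVec k‖ ^ 2 : ℝ) : ℂ)) •
          toComplexVec (perpR (latVec m) (latVec k))) =
      ((-(4 * Real.pi ^ 2) : ℝ) : ℂ) • ((S : ℂ) • u m - Y - M) := by
    rw [hY, hM, hSdef, Complex.ofReal_sum, Finset.sum_smul, ← Finset.sum_sub_distrib,
      ← Finset.sum_sub_distrib, Finset.smul_sum]
    refine Finset.sum_congr rfl fun k _ => ?_
    push_cast
    module
  rw [Pi.sub_apply, Pi.smul_apply, corrector_apply ha κ γ N hu hm, hX, laplacian_apply, hI]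
  have hS' : S = (d - 1) / d * ‖latVec m‖ ^ 2 := by
    field_simp
    linarith
  have hB' : B = (1 / d - E) / (d + 2) := by
    field_simp
    linarith
  have hd1 : (d : ℂ) - 1 ≠ 0 := by
    have : (d : ℝ) - 1 ≠ 0 := by linarith
    exact_mod_cast this
  have hd2 : (d : ℂ) + 2 ≠ 0 := by
    have : (d : ℝ) + 2 ≠ 0 := by linarith
    exact_mod_cast this
  have hd0 : (d : ℂ) ≠ 0 := by
    have : (d : ℝ) ≠ 0 := by linarith
    exact_mod_cast this
  -- Without the defect E, the coefficient is d/(d-1) · ((d-1)/d - 1/d + 1/(d(d+2))), which is the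
  -- effective viscosity.
  rw [hS', hB', effectiveViscosity]
  ext n
  simp only [PiLp.sub_apply, PiLp.add_apply, PiLp.smul_apply, smul_eq_mul]
  push_cast
  field_simp
  ring

theorem min_one_le_rpow {x α : ℝ} (hx : 0 ≤ x) (hα : α ∈ Set.Icc (0 : ℝ) 1) :
    min 1 x ≤ x ^ α := by
  rcases le_total 1 x with h | h
  · rw [min_eq_left h]; exact Real.one_le_rpow h hα.1
  · rw [min_eq_right h]
    rcases hx.eq_or_lt with rfl | hx0
    · exact Real.rpow_nonneg le_rfl _
    · simpa using Real.rpow_le_rpow_of_exponent_ge hx0 h hα.2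

/-- The multiplier bound for the difference of the corrector and its limit. -/
theorem exists_norm_corrector_sub_laplacian_le (hd : 2 ≤ d) {γ : ℝ} (hγ : 0 < γ) :
    ∃ C : ℝ, 0 < C ∧ ∀ a : (Fin d → ℤ) → Fin (d - 1) → EuclideanSpace ℝ (Fin d), IsNoiseFrame a →
      ∀ κ : ℝ, 0 < κ → ∀ N : ℕ, 1 ≤ N → ∀ α ∈ Set.Icc (0 : ℝ) 1, ∀ u : FourierSeries d,
      IsDivFree u → ∀ m : Fin d → ℤ, m ≠ 0 →
        ‖(corrector a κ (thetaN d γ N) u -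
          ((effectiveViscosity d * κ : ℝ) : ℂ) • laplacian u) m‖ ≤
        C * κ * decayN d γ N ^ α * (‖latVec m‖ ^ (2 + α) * ‖u m‖) := by
  have hd' : (2 : ℝ) ≤ d := by exact_mod_cast hd
  set p : Fin d := ⟨0, by omega⟩
  set q : Fin d := ⟨1, by omega⟩
  have hpq : p ≠ q := by simp [p, q]
  obtain ⟨C₀, hC₀, hE⟩ := exists_abs_anisotropy_le hpq hγ
  have hdd : 0 < (d : ℝ) / ((d : ℝ) - 1) := div_pos (by linarith) (by linarith)
  -- In 2 + 3 C₀ the 2 comes from the shift error; the 3 is 1 for the scalar part plus 2 from the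
  -- crude bound on the projection.
  refine ⟨4 * Real.pi ^ 2 * ((d : ℝ) / ((d : ℝ) - 1)) * (2 + 3 * C₀), by positivity, ?_⟩
  intro a ha κ hκ N hN α hα u hu m hm
  have hw : realDot (latVec m) (u m) = 0 := by rw [← latDot_eq]; exact hu m hm
  have hm1 := one_le_norm_latVec hm
  have hD0 := decayN_nonneg (d := d) γ N
  have hD1 := decayN_le_one p γ hN
  rw [corrector_sub_laplacian_apply hd hpq ha κ γ hN hu hm, norm_smul, Complex.norm_real,
    Real.norm_of_nonneg (by positivity)]
  set r := ‖latVec m‖ with hr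
  set D := decayN d γ N
  -- D_N is at most both 1 and |m| D_N, as |m| ≥ 1, so the defect obeys the same bound as the shift
  -- error.
  have hE' : |anisotropy γ N p q| ≤ C₀ * min 1 (r * D) := by
    rw [mul_min_of_nonneg _ _ hC₀.le]
    refine le_min ?_ ?_ <;> refine (hE N hN).trans (mul_le_mul_of_nonneg_left ?_ hC₀.le)
    · exact hD1
    · exact le_mul_of_one_le_left hD0 hm1
  have hZ : ‖((r ^ 2 / (d + 2) : ℝ) : ℂ) • u m -
      perpC (latVec m) (sqMul (latVec m) (u m))‖ ≤ 3 * (r ^ 2 * ‖u m‖) := by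
    refine (norm_sub_le _ _).trans ?_
    rw [norm_smul, Complex.norm_real, Real.norm_of_nonneg (by positivity)]
    have h1 : r ^ 2 / ((d : ℝ) + 2) ≤ r ^ 2 := div_le_self (by positivity) (by linarith)
    have h2 := (norm_perpC_le (latVec m) (sqMul (latVec m) (u m))).trans
      (mul_le_mul_of_nonneg_left (norm_sqMul_le _ _) zero_le_two)
    have h3 := mul_le_mul_of_nonneg_right h1 (norm_nonneg (u m))
    linarith
  have hmin := min_one_le_rpow (mul_nonneg (by linarith : 0 ≤ r) hD0) hα
  have hmin0 : 0 ≤ min 1 (r * D) := le_min zero_le_one (by positivity)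
  have hsum : ∀ Y Z : EuclideanSpace ℂ (Fin d), ‖Y‖ ≤ 2 * (r ^ 2 * ‖u m‖) * min 1 (r * D) →
      ‖Z‖ ≤ 3 * (r ^ 2 * ‖u m‖) →
      ‖Y + ((anisotropy γ N p q : ℝ) : ℂ) • Z‖ ≤
        (2 + 3 * C₀) * (D ^ α * (r ^ (2 + α) * ‖u m‖)) := fun Y Z hY hZ => by
    refine (norm_add_le _ _).trans ?_
    rw [norm_smul, Complex.norm_real, Real.norm_eq_abs]
    calc _ ≤ 2 * (r ^ 2 * ‖u m‖) * min 1 (r * D) +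
          (C₀ * min 1 (r * D)) * (3 * (r ^ 2 * ‖u m‖)) := by gcongr
      _ = (2 + 3 * C₀) * ((r ^ 2 * ‖u m‖) * min 1 (r * D)) := by ring
      _ ≤ (2 + 3 * C₀) * ((r ^ 2 * ‖u m‖) * (r * D) ^ α) := by gcongr
      _ = _ := by
        rw [Real.mul_rpow (by linarith) hD0, Real.rpow_add (by linarith), Real.rpow_two]
        ring
  refine (mul_le_mul_of_nonneg_left (hsum _ _
    (norm_sum_thetaN_sq_shift_le p γ hN (latVec m) hw) hZ) (by positivity)).trans (le_of_eq ?_)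
  ring

/-! ### Sobolev norms and reality of the corrector. -/

theorem sobolevTerm_nonneg (s : ℝ) (u : FourierSeries d) (k : Fin d → ℤ) :
    0 ≤ sobolevTerm s u k := by
  unfold sobolevTerm; positivity

/-- Comparison of Sobolev norms from a termwise comparison. -/
theorem summable_and_sobolevNorm_le {s t K : ℝ} (hK : 0 ≤ K) {u v : FourierSeries d}
    (hv : Summable fun k : {k : Fin d → ℤ // k ≠ 0} => sobolevTerm s v k)
    (h : ∀ k : Fin d → ℤ, k ≠ 0 → sobolevTerm t u k ≤ K ^ 2 * sobolevTerm s v k) :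
    (Summable fun k : {k : Fin d → ℤ // k ≠ 0} => sobolevTerm t u k) ∧
      sobolevNorm t u ≤ K * sobolevNorm s v := by
  have hsum : Summable fun k : {k : Fin d → ℤ // k ≠ 0} => sobolevTerm t u k :=
    Summable.of_nonneg_of_le (fun k => sobolevTerm_nonneg t u k) (fun k => h k k.2)
      (hv.mul_left (K ^ 2))
  refine ⟨hsum, ?_⟩
  rw [sobolevNorm, sobolevNorm, ← Real.sqrt_sq hK, ← Real.sqrt_mul (sq_nonneg K), ← tsum_mul_left]
  exact Real.sqrt_le_sqrt (hsum.tsum_le_tsum (fun k => h k k.2) (hv.mul_left (K ^ 2)))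

/-- The multiplier loses 2 + α powers of |k|, exactly the drop in Sobolev index; the factors 2π only
help since 2π ≥ 1 and 2 + α ≥ 0. -/
theorem sobolevTerm_le_of_multiplier {b α K : ℝ} (hα : 0 ≤ α) {u v : FourierSeries d}
    {k : Fin d → ℤ} (hk : k ≠ 0) (h : ‖u k‖ ≤ K * (‖latVec k‖ ^ (2 + α) * ‖v k‖)) :
    sobolevTerm (b - 2 - α) u k ≤ K ^ 2 * sobolevTerm b v k := by
  have hr : 0 < ‖latVec k‖ := zero_lt_one.trans_le (one_le_norm_latVec hk)
  have hpi : (1 : ℝ) ≤ 2 * Real.pi := by linarith [Real.pi_gt_three]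
  unfold sobolevTerm
  set r := ‖latVec k‖
  have h1 : ‖u k‖ ^ 2 ≤ K ^ 2 * ((2 * Real.pi * r) ^ (2 * (2 + α)) * ‖v k‖ ^ 2) := by
    calc ‖u k‖ ^ 2 ≤ (K * (r ^ (2 + α) * ‖v k‖)) ^ 2 := by gcongr
      _ = K ^ 2 * (r ^ (2 * (2 + α)) * ‖v k‖ ^ 2) := by
        rw [mul_comm 2 (2 + α), Real.rpow_mul hr.le, Real.rpow_two]; ring
      _ ≤ _ := by
        gcongr
        nlinarith
  calc _ ≤ (2 * Real.pi * r) ^ (2 * (b - 2 - α)) *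
        (K ^ 2 * ((2 * Real.pi * r) ^ (2 * (2 + α)) * ‖v k‖ ^ 2)) := by gcongr
    _ = K ^ 2 * (((2 * Real.pi * r) ^ (2 * (b - 2 - α)) * (2 * Real.pi * r) ^ (2 * (2 + α))) *
        ‖v k‖ ^ 2) := by ring
    _ = _ := by
      rw [← Real.rpow_add (by positivity)]
      ring_nf

theorem perpR_neg_neg (l k : EuclideanSpace ℝ (Fin d)) : perpR (-l) (-k) = -perpR l k := by
  simp only [perpR, inner_neg_neg, norm_neg, smul_neg]
  abel

theorem star_realDot (x : EuclideanSpace ℝ (Fin d)) (w : EuclideanSpace ℂ (Fin d)) :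
    star (realDot x w) = ∑ j, (x j : ℂ) * star (w j) := by
  simp [realDot]

/-- The corrector of a real field is real. -/
theorem star_corrector {a : (Fin d → ℤ) → Fin (d - 1) → EuclideanSpace ℝ (Fin d)}
    (ha : IsNoiseFrame a) (κ γ : ℝ) (N : ℕ) {u : FourierSeries d} (hu : IsDivFree u)
    (hr : ∀ (k : Fin d → ℤ) (j : Fin d), star (u k j) = u (-k) j) (m : Fin d → ℤ) (j : Fin d) :
    star (corrector a κ (thetaN d γ N) u m j) = corrector a κ (thetaN d γ N) u (-m) j := by
  rcases eq_or_ne m 0 with rfl | hm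
  · simp [corrector_zero]
  -- Reindexing by k ↦ -k matches the terms at -m with the conjugated terms at m; the signs from k·w
  -- and P_m k cancel.
  · rw [corrector_apply ha κ γ N hu (neg_ne_zero.mpr hm), ← sum_latticeBall_neg,
      corrector_apply ha κ γ N hu hm]
    simp only [PiLp.smul_apply, smul_eq_mul, WithLp.ofLp_sum, Finset.sum_apply, star_mul',
      star_sum, PiLp.sub_apply, star_sub]
    refine congrArg₂ _ (by simp) (Finset.sum_congr rfl fun k hk => ?_)
    have hk' : -k ∈ latticeBall d N := by
      rw [mem_latticeBall, norm_latVec_neg, ← mem_latticeBall]; exact hk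
    have h1 : star (realDot (latVec k) (u m)) = -realDot (latVec (-k)) (u (-m)) := by
      rw [star_realDot, realDot, ← Finset.sum_neg_distrib]
      exact Finset.sum_congr rfl fun i _ => by rw [hr, latVec_neg]; simp
    have h2 : ‖latVec (-m) - latVec (-k)‖ = ‖latVec m - latVec k‖ := by
      rw [latVec_neg, latVec_neg, ← neg_sub', norm_neg]
    have h3 : sinSq (latVec (-k)) (latVec (-m)) = sinSq (latVec k) (latVec m) := by
      simp only [sinSq, latVec_neg, inner_neg_neg, norm_neg]
    have h4 : thetaN d γ N (-k) ^ 2 = thetaN d γ N k ^ 2 := by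
      rw [thetaN_sq hk, thetaN_sq hk', norm_latVec_neg]
    have h5 : toComplexVec (perpR (latVec (-m)) (latVec (-k))) j =
        -toComplexVec (perpR (latVec m) (latVec k)) j := by
      rw [latVec_neg, latVec_neg, perpR_neg_neg]
      simp [toComplexVec_apply]
    rw [h2, h3, h4, h5, ← hr m j, div_eq_mul_inv, div_eq_mul_inv, star_mul', h1]
    simp [toComplexVec_apply]

theorem star_laplacian {u : FourierSeries d}
    (hr : ∀ (k : Fin d → ℤ) (j : Fin d), star (u k j) = u (-k) j) (m : Fin d → ℤ) (j : Fin d) :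
    star (laplacian u m j) = laplacian u (-m) j := by
  rw [laplacian_apply, laplacian_apply, norm_latVec_neg, PiLp.smul_apply, PiLp.smul_apply,
    smul_eq_mul, smul_eq_mul, star_mul', hr]
  simp

/-- Convergence of the corrector to the effective viscosity, in any dimension `d ≥ 2`. -/
theorem exists_sobolevNorm_corrector_sub_laplacian_le (hd : 2 ≤ d) {γ : ℝ} (hγ : 0 < γ) :
    ∃ C : ℝ, 0 < C ∧
      ∀ a : (Fin d → ℤ) → Fin (d - 1) → EuclideanSpace ℝ (Fin d), IsNoiseFrame a →
      ∀ κ : ℝ, 0 < κ → ∀ N : ℕ, 1 ≤ N → ∀ α ∈ Set.Icc (0 : ℝ) 1, ∀ b : ℝ,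
      ∀ v : FourierSeries d, MemSobolev b v → IsDivFree v →
        MemSobolev (b - 2 - α)
          (corrector a κ (thetaN d γ N) v -
            ((effectiveViscosity d * κ : ℝ) : ℂ) • laplacian v) ∧
        sobolevNorm (b - 2 - α)
          (corrector a κ (thetaN d γ N) v -
            ((effectiveViscosity d * κ : ℝ) : ℂ) • laplacian v)
          ≤ C * κ * decayN d γ N ^ α * sobolevNorm b v := by
  obtain ⟨C, hC, h⟩ := exists_norm_corrector_sub_laplacian_le hd hγ
  refine ⟨C, hC, fun a ha κ hκ N hN α hα b v hv hdiv => ?_⟩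
  have hK : 0 ≤ C * κ * decayN d γ N ^ α :=
    mul_nonneg (by positivity) (Real.rpow_nonneg (decayN_nonneg γ N) α)
  obtain ⟨hsum, hnorm⟩ := summable_and_sobolevNorm_le (t := b - 2 - α) hK hv.summable fun k hk =>
    sobolevTerm_le_of_multiplier hα.1 hk (h a ha κ hκ N hN α hα v hdiv k hk)
  refine ⟨⟨?_, fun k j => ?_, hsum⟩, hnorm⟩
  · rw [Pi.sub_apply, corrector_zero, Pi.smul_apply, laplacian_apply, hv.zero_average]
    simp
  · rw [Pi.sub_apply, Pi.sub_apply, PiLp.sub_apply, PiLp.sub_apply, star_sub,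
      star_corrector ha κ γ N hdiv hv.real_valued, Pi.smul_apply, Pi.smul_apply, PiLp.smul_apply,
      PiLp.smul_apply, smul_eq_mul, smul_eq_mul, star_mul', star_laplacian hv.real_valued]
    simp

end ItoCorrector


open ItoCorrector

theorem theorem3p3 :
    (∀ γ : ℝ, 0 < γ → γ < 1 →
      ∃ C : ℝ, 0 < C ∧
        ∀ a : (Fin 2 → ℤ) → Fin (2 - 1) → EuclideanSpace ℝ (Fin 2), IsNoiseFrame a →
        ∀ κ : ℝ, 0 < κ → ∀ N : ℕ, 1 ≤ N → ∀ α ∈ Set.Icc (0 : ℝ) 1, ∀ b : ℝ,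
        ∀ v : FourierSeries 2, MemSobolev b v → IsDivFree v →
          MemSobolev (b - 2 - α)
              (corrector a κ (thetaN 2 γ N) v - (((1 / 4 : ℝ) * κ : ℝ) : ℂ) • laplacian v) ∧
          sobolevNorm (b - 2 - α)
              (corrector a κ (thetaN 2 γ N) v - (((1 / 4 : ℝ) * κ : ℝ) : ℂ) • laplacian v)
            ≤ C * κ * decayN 2 γ N ^ α * sobolevNorm b v) ∧
    (∀ γ : ℝ, 0 < γ → γ < 3 / 2 →
      ∃ C : ℝ, 0 < C ∧
        ∀ a : (Fin 3 → ℤ) → Fin (3 - 1) → EuclideanSpace ℝ (Fin 3), IsNoiseFrame a →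
        ∀ κ : ℝ, 0 < κ → ∀ N : ℕ, 1 ≤ N → ∀ α ∈ Set.Icc (0 : ℝ) 1, ∀ b : ℝ,
        ∀ v : FourierSeries 3, MemSobolev b v → IsDivFree v →
          MemSobolev (b - 2 - α)
              (corrector a κ (thetaN 3 γ N) v - (((3 / 5 : ℝ) * κ : ℝ) : ℂ) • laplacian v) ∧
          sobolevNorm (b - 2 - α)
              (corrector a κ (thetaN 3 γ N) v - (((3 / 5 : ℝ) * κ : ℝ) : ℂ) • laplacian v)
            ≤ C * κ * decayN 3 γ N ^ α * sobolevNorm b v) := by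
  have h2 : effectiveViscosity 2 = 1 / 4 := by norm_num [effectiveViscosity]
  have h3 : effectiveViscosity 3 = 3 / 5 := by norm_num [effectiveViscosity]
  constructor
  · intro γ hγ _
    have h := exists_sobolevNorm_corrector_sub_laplacian_le (d := 2) le_rfl hγ
    rwa [h2] at h
  · intro γ hγ _
    have h := exists_sobolevNorm_corrector_sub_laplacian_le (d := 3) (by norm_num) hγ
    rwa [h3] at h
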